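/- Let $L$ be a number field of degree $4$ over $\mathbb{Q}$ whose Galois closure over $\mathbb{Q}$ has Galois group isomorphic to the dihedral group $D_4$ of order $8$, and suppose that $L$ has signature $(2,1)$, that is, two real embeddings $\sigma_1,\sigma_2$ and one pair $\tau,\overline{\tau}$ of complex conjugate embeddings. Let $E_L$ be the group $\mathcal{O}_L^\times$ modulo torsion, embedded in Euclidean space $\mathbb{R}^3$ by $$u\mapsto(\log|\sigma_1(u)|,\ \log|\sigma_2(u)|,\ 2\log|\tau(u)|),$$ with the induced norm (the unit lattice of $L$). Let $\mathscr{F}=\{x+iy : 0\le x\le \tfrac12,\ y>0,\ x^2+y^2\ge 1\}$ be the standard fundamental domain of $\mathrm{GL}_2(\mathbb{Z})\backslash\mathfrak{h}$, where $\mathfrak{h}$ is the upper half plane. Then there is exactly one point $p_L\in\mathscr{F}$ such that $E_L$ is equal to the lattice $\mathbb{Z}+\mathbb{Z}p_L\subset\mathbb{C}$ up to scaling, rotation and reflection. The complex number $p_L=x+iy$ is transcendental (over $\mathbb{Q}$), and it lies on the boundary of $\mathscr{F}$, that is, on at least one of 1. the left vertical line $x=0$, $y\ge 1$; 2. the arc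 $x^2+y^2=1$, $0\le x\le\tfrac12$, $y>0$; 3. the right vertical line $x=\tfrac12$, $y\ge\tfrac{\sqrt3}{2}$. Moreover, if $K\subset L$ is a quadratic subfield and $\sigma$ is the nontrivial automorphism of $L$ over $K$, then the action of $\sigma$ on $\mathcal{O}_L^\times$ induces an automorphism of the group $E_L$ which preserves the norm and is different from $+1$ and $-1$. -/

import Mathlib

open NumberField UpperHalfPlane

noncomputable section

namespace UnitShape

/-- A `D₄`-quartic field: a number field of degree `4` over `ℚ` whose Galois closure has Galois
group isomorphic to the dihedral group of order `8`. -/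
def IsD4Quartic (L : Type*) [Field L] [NumberField L] : Prop :=
  Module.finrank ℚ L = 4 ∧
    Nonempty ((IntermediateField.normalClosure ℚ L (AlgebraicClosure ℚ) ≃ₐ[ℚ]
      IntermediateField.normalClosure ℚ L (AlgebraicClosure ℚ)) ≃* DihedralGroup 4)

/-- The number field `L` has signature `(r, s)`: it has `r` real embeddings and `s` pairs of complex
conjugate embeddings. -/
def HasSignature (L : Type*) [Field L] [NumberField L] (r s : ℕ) : Prop :=
  InfinitePlace.nrRealPlaces L = r ∧ InfinitePlace.nrComplexPlaces L = s

/-- The logarithmic embedding of the unit group. The coordinate of `u` at the infinite place `w` is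
`log |σ u|` if `w` comes from a real embedding `σ`, and `2 * log |τ u|` if `w` comes from a pair
`τ, τ̄` of complex embeddings. The kernel consists of the roots of unity, so this is
the embedding of the units modulo torsion. All infinite places are used, and the target carries the
standard Euclidean norm. -/
def logEmb (L : Type*) [Field L] [NumberField L] :
    Additive (𝓞 L)ˣ →+ EuclideanSpace ℝ (InfinitePlace L) where
  toFun u := WithLp.toLp 2 fun w => (w.mult : ℝ) * Real.log (w ((u.toMul : 𝓞 L) : L))
  map_zero' := by
    ext w
    simp
  map_add' u v := by
    ext w
    have hu : w ((u.toMul : 𝓞 L) : L) ≠ 0 := by simp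
    have hv : w ((v.toMul : 𝓞 L) : L) ≠ 0 := by simp
    simp only [toMul_add, Units.val_mul, map_mul, PiLp.add_apply]
    rw [Real.log_mul hu hv, mul_add]

/-- The unit lattice of `L`, i.e. the image of the logarithmic embedding, with the induced norm. -/
def unitLattice (L : Type*) [Field L] [NumberField L] :
    AddSubgroup (EuclideanSpace ℝ (InfinitePlace L)) :=
  (logEmb L).range

/-- The class in the unit lattice of a unit of `𝓞 L`. -/
def unitClass {L : Type*} [Field L] [NumberField L] (u : (𝓞 L)ˣ) : unitLattice L :=
  ⟨logEmb L (Additive.ofMul u), ⟨Additive.ofMul u, rfl⟩⟩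

/-- The lattice `ℤ + ℤ z` in `ℂ`. -/
def planeLattice (z : ℍ) : AddSubgroup ℂ :=
  AddSubgroup.closure {1, (z : ℂ)}

/-- The unit lattice of `L` and the lattice `ℤ + ℤ z` agree up to scaling, rotation and reflection,
i.e. `z` represents the unit shape of `L` in `GL₂(ℤ)\ℍ`. -/
def HasUnitShape (L : Type*) [Field L] [NumberField L] (z : ℍ) : Prop :=
  ∃ (f : planeLattice z ≃+ unitLattice L) (c : ℝ), 0 < c ∧ ∀ x, ‖f x‖ = c * ‖x‖

/-- The standard fundamental domain of `GL₂(ℤ)\ℍ`. -/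
def stdDomain : Set ℍ :=
  {z | 0 ≤ z.re ∧ z.re ≤ 1 / 2 ∧ 1 ≤ z.re ^ 2 + z.im ^ 2}

/-- `p` is the point `p_L`: the one and only point of the standard fundamental domain which
represents the unit shape of `L`. -/
def IsUnitShapePoint (L : Type*) [Field L] [NumberField L] (p : ℍ) : Prop :=
  (p ∈ stdDomain ∧ HasUnitShape L p) ∧ ∀ q : ℍ, q ∈ stdDomain → HasUnitShape L q → q = p

end UnitShape

end

/-!
Let `σ` be the nontrivial automorphism of `L` over a quadratic subfield. A quadratic subfield exists
because in the Galois group, of order `8`, the group of order `2` fixing `L` lies in a group of order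
`4` (`exists_quadratic_subfield`). An automorphism other than the identity fixes no real place, so
`σ` exchanges the two real places and fixes the complex one (`comap_places`). It acts on the
logarithmic space as the reflection exchanging the first two coordinates; by Dirichlet's unit theorem
the unit lattice spans the plane where the coordinate sum vanishes, so this reflection is neither `1`
nor `-1` on it.

A plane lattice `Λ` with a reflection has a fixed vector `v` and an orthogonal antifixed vector `v'`,
generators of the two eigenlattices, and `Λ` is either `ℤv + ℤv'` or the rhombic lattice spanned by
`(v + v') / 2` and `(v' - v) / 2` (`eq_closure_or_eq_closure_half`). In terms of `r = ‖v'‖ / ‖v‖`,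
taken to be at least `1`, its shape is `ir` in the first case; in the second case it is `(1 + ir) / 2`
if `r ^ 2 ≥ 3` and `(r + i) / (r - i)` if `r ^ 2 < 3`
(`exists_boundary_point_of_orthogonal_of_norm_le`). All of these lie on the boundary of the standard
domain, and they are transcendental as soon as `r` is. Uniqueness of the point in the domain holds
because the norms of the lattice determine its first two minima and its covolume
(`eq_of_planeLattice_similar`).

Here `v` and `v'` are multiples of `(1, 1, -2)` and `(1, -1, 0)`, so `r` is, up to `√3`, a quotient of
logarithms of absolute values of units at a real place, and by the Gelfond–Schneider theorem this
quotient is rational or transcendental. It is not rational, since a unit of absolute value `1` at a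
real place is `1` or `-1`, so that a rational quotient would make `v` and `v'` linearly dependent.

For real numbers the Gelfond–Schneider theorem (`not_irrational_log_div_log`) has a proof by real
analysis. If `a > 0`, `a ≠ 1`, `β` and `a ^ β` are algebraic with `β` irrational, take the determinant
of the values of the functions `x ^ p * a ^ (q x)`, `p < T₀`, `q < T₁`, at the `S ^ 2 = T₀ T₁` points
`s + t β`, `s, t < S`.

* It is not zero, because by Rolle's theorem a real exponential polynomial has fewer zeros than
  coefficients (`eq_zero_of_sum_eval_mul_exp_eq_zero`, `det_pow_mul_exp_ne_zero`).
* It is very small: in the Newton basis the matrix of values becomes a matrix of divided differences,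
  which are derivatives divided by factorials (`abs_det_interpolation_le`).
* It is an algebraic number of controlled denominator and conjugates, so it cannot be that small
  without vanishing (`one_le_norm_det_mul_pow`).

With `S = n ^ 2`, `T₀ = n ^ 3`, `T₁ = n` the bounds contradict each other for large `n`.
-/

namespace UnitShape

/-! ### Rolle's theorem and interpolation determinants -/

/-- Rolle's theorem for several zeros. -/
theorem exists_finset_deriv_eq_zero {f : ℝ → ℝ} (hf : Continuous f) (s : Finset ℝ)
    (hs : ∀ x ∈ s, f x = 0) {a b : ℝ} (hab : ∀ x ∈ s, x ∈ Set.Icc a b) :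
    ∃ t : Finset ℝ, s.card ≤ t.card + 1 ∧ (∀ x ∈ t, deriv f x = 0) ∧ ∀ x ∈ t, x ∈ Set.Icc a b := by
  rcases Nat.eq_zero_or_pos s.card with h0 | h0
  · exact ⟨∅, by simp [h0], by simp, by simp⟩
  obtain ⟨n, hn⟩ : ∃ n, s.card = n + 1 := ⟨s.card - 1, by omega⟩
  let x := s.orderEmbOfFin hn
  have hx : ∀ i, x i ∈ s := fun i => Finset.orderEmbOfFin_mem s hn i
  have key : ∀ i : Fin n, ∃ c ∈ Set.Ioo (x i.castSucc) (x i.succ), deriv f c = 0 := fun i =>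
    exists_deriv_eq_zero (x.strictMono i.castSucc_lt_succ) hf.continuousOn
      (by rw [hs _ (hx _), hs _ (hx _)])
  choose y hy hy0 using key
  have hmono : StrictMono y := by
    intro i j hij
    have h1 : x i.succ ≤ x j.castSucc := x.monotone (Fin.succ_le_castSucc_iff.2 hij)
    linarith [(hy i).2, (hy j).1]
  refine ⟨Finset.univ.map ⟨y, hmono.injective⟩, by simp [hn], ?_, ?_⟩
  · simp only [Finset.mem_map, Finset.mem_univ, true_and, Function.Embedding.coeFn_mk]
    rintro _ ⟨i, rfl⟩
    exact hy0 i
  · simp only [Finset.mem_map, Finset.mem_univ, true_and, Function.Embedding.coeFn_mk]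
    rintro _ ⟨i, rfl⟩
    have h1 := hab _ (hx i.castSucc)
    have h2 := hab _ (hx i.succ)
    exact ⟨h1.1.trans (hy i).1.le, (hy i).2.le.trans h2.2⟩

theorem exists_finset_iteratedDeriv_eq_zero {f : ℝ → ℝ} (hf : ContDiff ℝ ⊤ f) (s : Finset ℝ)
    (hs : ∀ x ∈ s, f x = 0) {a b : ℝ} (hab : ∀ x ∈ s, x ∈ Set.Icc a b) (k : ℕ) :
    ∃ t : Finset ℝ, s.card ≤ t.card + k ∧ (∀ x ∈ t, iteratedDeriv k f x = 0) ∧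
      ∀ x ∈ t, x ∈ Set.Icc a b := by
  induction k with
  | zero => exact ⟨s, by simp, by simpa using hs, hab⟩
  | succ k ih =>
    obtain ⟨t, ht, ht0, htab⟩ := ih
    obtain ⟨t', h1, h2, h3⟩ := exists_finset_deriv_eq_zero
      (hf.continuous_iteratedDeriv k (by exact_mod_cast le_top)) t ht0 htab
    exact ⟨t', by omega, by simpa [iteratedDeriv_succ] using h2, h3⟩

theorem iteratedDeriv_polynomial_eval (p : Polynomial ℝ) (k : ℕ) :
    iteratedDeriv k (fun x => p.eval x) = fun x => (Polynomial.derivative^[k] p).eval x := by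
  induction k with
  | zero => simp
  | succ k ih =>
    rw [iteratedDeriv_succ, ih, Function.iterate_succ_apply']
    ext x
    simp

/-- Newton's form of the interpolating polynomial: the values of a function at the nodes
`x 0, …, x (n - 1)` are triangular in the Newton basis. -/
theorem exists_newton_coeff {F : Type*} [Field F] {x : ℕ → F} (f : F → F) (n : ℕ)
    (hx : Set.InjOn x (Set.Iio n)) :
    ∃ d : ℕ → F, ∀ j < n, f (x j) =
      ∑ k ∈ Finset.range n, d k * ∏ m ∈ Finset.range k, (x j - x m) := by
  induction n with
  | zero => exact ⟨0, by simp⟩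
  | succ n ih =>
    obtain ⟨d, hd⟩ := ih (hx.mono (Set.Iio_subset_Iio n.le_succ))
    have hne : ∏ m ∈ Finset.range n, (x n - x m) ≠ 0 := by
      refine Finset.prod_ne_zero_iff.2 fun m hm => sub_ne_zero.2 fun h => ?_
      have hm' := Finset.mem_range.1 hm
      have := hx (Set.mem_Iio.2 n.lt_succ_self) (Set.mem_Iio.2 (hm'.trans n.lt_succ_self)) h
      omega
    refine ⟨Function.update d n ((f (x n) - ∑ k ∈ Finset.range n,
      d k * ∏ m ∈ Finset.range k, (x n - x m)) / ∏ m ∈ Finset.range n, (x n - x m)), ?_⟩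
    intro j hj
    have hsum : ∑ k ∈ Finset.range n, Function.update d n ((f (x n) - ∑ k ∈ Finset.range n,
        d k * ∏ m ∈ Finset.range k, (x n - x m)) / ∏ m ∈ Finset.range n, (x n - x m)) k *
          ∏ m ∈ Finset.range k, (x j - x m) =
        ∑ k ∈ Finset.range n, d k * ∏ m ∈ Finset.range k, (x j - x m) := by
      refine Finset.sum_congr rfl fun k hk => ?_
      rw [Function.update_of_ne (Finset.mem_range.1 hk).ne]
    rw [Finset.sum_range_succ, hsum, Function.update_self]
    rcases Nat.lt_succ_iff_lt_or_eq.1 hj with h | rfl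
    · have h0 : ∏ m ∈ Finset.range n, (x j - x m) = 0 :=
        Finset.prod_eq_zero (Finset.mem_range.2 h) (sub_self _)
      rw [h0, mul_zero, add_zero, hd j h]
    · rw [div_mul_cancel₀ _ hne]
      ring

/-- A divided difference of order `k` is a value of the `k`-th derivative divided by `k!`. -/
theorem exists_iteratedDeriv_eq_newton_coeff {f : ℝ → ℝ} (hf : ContDiff ℝ ⊤ f) {x d : ℕ → ℝ}
    {n : ℕ} (hx : Set.InjOn x (Set.Iio n)) {a b : ℝ} (hab : ∀ j < n, x j ∈ Set.Icc a b)
    (hd : ∀ j < n, f (x j) = ∑ k ∈ Finset.range n, d k * ∏ m ∈ Finset.range k, (x j - x m))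
    {k : ℕ} (hk : k < n) :
    ∃ y ∈ Set.Icc a b, iteratedDeriv k f y = k.factorial * d k := by
  let B : ℕ → Polynomial ℝ := fun i => ∏ m ∈ Finset.range i, (Polynomial.X - Polynomial.C (x m))
  have hBm : ∀ i, (B i).Monic := fun i => Polynomial.monic_prod_X_sub_C _ _
  have hBd : ∀ i, (B i).natDegree = i := fun i => by
    simp [B]
  let P : Polynomial ℝ := ∑ i ∈ Finset.range (k + 1), Polynomial.C (d i) * B i
  have hPe : ∀ j < k + 1, P.eval (x j) = f (x j) := by
    intro j hj
    rw [hd j (by omega), ← Finset.sum_subset (Finset.range_subset_range.2 (Nat.succ_le_of_lt hk))]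
    · simp [P, B, Polynomial.eval_finsetSum, Polynomial.eval_prod]
    · intro i _ hi
      rw [Finset.mem_range, not_lt] at hi
      rw [Finset.prod_eq_zero (Finset.mem_range.2 (lt_of_lt_of_le hj hi)) (sub_self _), mul_zero]
  have hPd : P.natDegree ≤ k := by
    refine Polynomial.natDegree_sum_le_of_forall_le _ _ fun i hi => ?_
    refine (Polynomial.natDegree_C_mul_le _ _).trans ?_
    rw [hBd]
    exact Nat.lt_succ_iff.1 (Finset.mem_range.1 hi)
  have hPc : P.coeff k = d k := by
    simp only [P, Polynomial.finsetSum_coeff, Polynomial.coeff_C_mul]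
    rw [Finset.sum_range_succ, Finset.sum_eq_zero]
    · have := (hBm k).coeff_natDegree
      rw [hBd] at this
      simp [this]
    · intro i hi
      rw [Polynomial.coeff_eq_zero_of_natDegree_lt (by rw [hBd]; exact Finset.mem_range.1 hi),
        mul_zero]
  have hPk : Polynomial.derivative^[k] P = Polynomial.C ((k.factorial : ℝ) * d k) := by
    have hdeg : (Polynomial.derivative^[k] P).natDegree ≤ 0 := by
      refine (Polynomial.natDegree_iterate_derivative P k).trans ?_
      omega
    rw [Polynomial.eq_C_of_natDegree_le_zero hdeg, Polynomial.coeff_iterate_derivative, zero_add,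
      hPc, Nat.descFactorial_self, nsmul_eq_mul]
  have hPs : ContDiff ℝ ⊤ fun y => P.eval y := by
    simpa using P.contDiff_aeval (𝕜 := ℝ) ⊤
  have hinj : Set.InjOn x (Finset.range (k + 1)) := hx.mono fun i hi => by
    have := Finset.mem_range.1 (Finset.mem_coe.1 hi)
    exact Set.mem_Iio.2 (by omega)
  obtain ⟨t, ht, ht0, htab⟩ := exists_finset_iteratedDeriv_eq_zero (hf.sub hPs)
    ((Finset.range (k + 1)).image x) (by
      intro y hy
      obtain ⟨j, hj, rfl⟩ := Finset.mem_image.1 hy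
      simp [hPe j (Finset.mem_range.1 hj)]) (a := a) (b := b) (by
      intro y hy
      obtain ⟨j, hj, rfl⟩ := Finset.mem_image.1 hy
      have := Finset.mem_range.1 hj
      exact hab j (by omega)) k
  rw [Finset.card_image_of_injOn hinj, Finset.card_range] at ht
  obtain ⟨y, hy⟩ : t.Nonempty := Finset.card_pos.1 (by omega)
  refine ⟨y, htab y hy, ?_⟩
  have h := ht0 y hy
  have h2 := iteratedDeriv_sub (n := k) (x := y) (f := f) (g := fun y => P.eval y)
    (hf.contDiffAt.of_le (by exact_mod_cast le_top))
    (hPs.contDiffAt.of_le (by exact_mod_cast le_top))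
  rw [iteratedDeriv_polynomial_eval, hPk] at h2
  have h3 : iteratedDeriv k (f - fun y => P.eval y) y = 0 := h
  simp only [h3, Polynomial.eval_C] at h2
  linarith

theorem norm_det_le_factorial_mul_prod {𝕜 : Type*} [NormedField 𝕜] {n : Type*} [Fintype n]
    [DecidableEq n] (M : Matrix n n 𝕜) (c : n → ℝ) (hM : ∀ i k, ‖M i k‖ ≤ c k) :
    ‖M.det‖ ≤ (Fintype.card n).factorial * ∏ k, c k := by
  rw [Matrix.det_apply']
  refine (norm_sum_le _ _).trans ?_
  have : ∀ σ ∈ (Finset.univ : Finset (Equiv.Perm n)),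
      ‖((Equiv.Perm.sign σ : ℤ) : 𝕜) * ∏ i, M (σ i) i‖ ≤ ∏ k, c k := by
    intro σ _
    have h1 : ‖((Equiv.Perm.sign σ : ℤ) : 𝕜)‖ = 1 := by
      rcases Int.units_eq_one_or (Equiv.Perm.sign σ) with h | h <;> simp [h]
    rw [norm_mul, h1, one_mul, norm_prod]
    exact Finset.prod_le_prod (fun _ _ => norm_nonneg _) fun i _ => hM _ _
  refine (Finset.sum_le_sum this).trans ?_
  rw [Finset.sum_const, Finset.card_univ, Fintype.card_perm, nsmul_eq_mul]

/-- An interpolation determinant formed with smooth functions is small. The matrix of values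
factors through the Newton basis; the factor of divided differences is bounded by derivatives,
and the triangular factor has as determinant a product of differences of nodes. -/
theorem abs_det_interpolation_le {N : ℕ} {f : Fin N → ℝ → ℝ} (hf : ∀ i, ContDiff ℝ ⊤ (f i))
    {x : Fin N → ℝ} (hx : Function.Injective x) {R : ℝ} (hR : ∀ j, |x j| ≤ R)
    {M : ℕ → ℝ} (hM : ∀ i, ∀ k, ∀ y, |y| ≤ R → |iteratedDeriv k (f i) y| ≤ M k) :
    |(Matrix.of fun i j => f i (x j)).det| ≤
      N.factorial * ∏ k ∈ Finset.range N, ((2 * R) ^ k * (M k / k.factorial)) := by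
  rcases Nat.eq_zero_or_pos N with rfl | hN
  · simp
  have hR0 : 0 ≤ R := (abs_nonneg _).trans (hR ⟨0, hN⟩)
  have hM0 : ∀ k, 0 ≤ M k := fun k =>
    (abs_nonneg _).trans (hM ⟨0, hN⟩ k 0 (by simpa using hR0))
  let x' : ℕ → ℝ := fun j => if h : j < N then x ⟨j, h⟩ else 0
  have hx' : ∀ j : Fin N, x' j = x j := fun j => by simp [x']
  have hx'R : ∀ j, |x' j| ≤ R := fun j => by
    by_cases h : j < N
    · simpa [x', h] using hR ⟨j, h⟩
    · simpa [x', h] using hR0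
  have hinj : Set.InjOn x' (Set.Iio N) := by
    intro i hi j hj h
    have h1 : x ⟨i, hi⟩ = x ⟨j, hj⟩ := by
      rw [← hx', ← hx']; exact h
    exact Fin.mk.inj (hx h1)
  choose d hd using fun i => exists_newton_coeff (f i) N hinj
  let A : Matrix (Fin N) (Fin N) ℝ := Matrix.of fun i k => d i k
  let U : Matrix (Fin N) (Fin N) ℝ :=
    Matrix.of fun k j => ∏ m ∈ Finset.range (k : ℕ), (x' j - x' m)
  have hAU : (Matrix.of fun i j => f i (x j)) = A * U := by
    ext i j
    simp only [Matrix.of_apply, Matrix.mul_apply, A, U]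
    rw [← hx' j, hd i j j.2, Finset.sum_range]
  have hA : |A.det| ≤ N.factorial * ∏ k : Fin N, (M k / (k : ℕ).factorial) := by
    have := norm_det_le_factorial_mul_prod A (fun k => M k / (k : ℕ).factorial) (by
      intro i k
      obtain ⟨y, hy, hyk⟩ := exists_iteratedDeriv_eq_newton_coeff (hf i) hinj (a := -R) (b := R)
        (fun j _ => abs_le.1 (hx'R j)) (hd i) k.2
      have h1 := hM i k y (abs_le.2 hy)
      rw [hyk, abs_mul, Nat.abs_cast] at h1
      rw [Real.norm_eq_abs, le_div_iff₀ (by positivity), mul_comm]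
      exact h1)
    simpa using this
  have hUt : U.BlockTriangular id := by
    intro k j hjk
    exact Finset.prod_eq_zero (Finset.mem_range.2 (Fin.lt_def.1 hjk)) (sub_self _)
  have hU : |U.det| ≤ ∏ k : Fin N, (2 * R) ^ (k : ℕ) := by
    rw [Matrix.det_of_isUpperTriangular hUt, Finset.abs_prod]
    refine Finset.prod_le_prod (fun _ _ => abs_nonneg _) fun k _ => ?_
    simp only [U, Matrix.of_apply]
    rw [Finset.abs_prod]
    refine (Finset.prod_le_prod (fun _ _ => abs_nonneg _) (g := fun _ => 2 * R) fun m _ => ?_).trans ?_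
    · have h1 := abs_le.1 (hx'R k)
      have h2 := abs_le.1 (hx'R m)
      exact abs_le.2 ⟨by linarith, by linarith⟩
    · simp
  rw [hAU, Matrix.det_mul, abs_mul, Finset.prod_mul_distrib, Finset.prod_range, Finset.prod_range]
  calc |A.det| * |U.det| ≤ (N.factorial * ∏ k : Fin N, (M k / (k : ℕ).factorial)) *
        ∏ k : Fin N, (2 * R) ^ (k : ℕ) := by
        gcongr
        exact mul_nonneg (by positivity)
          (Finset.prod_nonneg fun k _ => div_nonneg (hM0 k) (by positivity))
    _ = _ := by ring

/-! ### Zeros of real exponential polynomials -/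

open Polynomial in
/-- The effect of differentiation on the polynomial factor of `P(x) exp(a x)`. -/
noncomputable def expDeriv (a : ℝ) (P : ℝ[X]) : ℝ[X] := derivative P + C a * P

theorem hasDerivAt_eval_mul_exp (P : Polynomial ℝ) (a x : ℝ) :
    HasDerivAt (fun x => P.eval x * Real.exp (a * x))
      ((expDeriv a P).eval x * Real.exp (a * x)) x := by
  have h1 := P.hasDerivAt x
  have h2 : HasDerivAt (fun x => Real.exp (a * x)) (Real.exp (a * x) * (a * 1)) x :=
    ((hasDerivAt_id x).const_mul a).exp
  refine (h1.mul h2).congr_deriv ?_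
  simp only [expDeriv, Polynomial.eval_add, Polynomial.eval_mul, Polynomial.eval_C]
  ring

theorem iteratedDeriv_sum_eval_mul_exp {ι : Type*} (s : Finset ι) (P : ι → Polynomial ℝ)
    (a : ι → ℝ) (k : ℕ) :
    iteratedDeriv k (fun x => ∑ i ∈ s, (P i).eval x * Real.exp (a i * x)) =
      fun x => ∑ i ∈ s, ((expDeriv (a i))^[k] (P i)).eval x * Real.exp (a i * x) := by
  induction k with
  | zero => simp
  | succ k ih =>
    rw [iteratedDeriv_succ, ih]
    ext x
    simp only [Function.iterate_succ_apply']
    exact (HasDerivAt.fun_sum fun i _ => hasDerivAt_eval_mul_exp _ (a i) x).deriv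

theorem natDegree_expDeriv_le (a : ℝ) (P : Polynomial ℝ) :
    (expDeriv a P).natDegree ≤ P.natDegree := by
  refine (Polynomial.natDegree_add_le _ _).trans (max_le ?_ (Polynomial.natDegree_C_mul_le _ _))
  exact (Polynomial.natDegree_derivative_le P).trans (Nat.sub_le _ _)

theorem natDegree_expDeriv_iterate_le (a : ℝ) (P : Polynomial ℝ) (k : ℕ) :
    ((expDeriv a)^[k] P).natDegree ≤ P.natDegree := by
  induction k with
  | zero => rfl
  | succ k ih =>
    rw [Function.iterate_succ_apply']
    exact (natDegree_expDeriv_le _ _).trans ih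

theorem eq_zero_of_expDeriv_eq_zero {a : ℝ} (ha : a ≠ 0) {P : Polynomial ℝ}
    (h : expDeriv a P = 0) : P = 0 := by
  by_contra hP
  have h1 : (expDeriv a P).degree = P.degree := by
    rw [expDeriv, Polynomial.degree_add_eq_right_of_degree_lt, Polynomial.degree_C_mul ha]
    rw [Polynomial.degree_C_mul ha]
    exact Polynomial.degree_derivative_lt hP
  rw [h, Polynomial.degree_zero] at h1
  exact hP (Polynomial.degree_eq_bot.1 h1.symm)

theorem eq_zero_of_expDeriv_iterate_eq_zero {a : ℝ} (ha : a ≠ 0) {P : Polynomial ℝ} {k : ℕ}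
    (h : (expDeriv a)^[k] P = 0) : P = 0 := by
  induction k with
  | zero => exact h
  | succ k ih =>
    rw [Function.iterate_succ_apply'] at h
    exact ih (eq_zero_of_expDeriv_eq_zero ha h)

theorem expDeriv_zero_iterate_eq_zero {P : Polynomial ℝ} {k : ℕ} (h : P.natDegree < k) :
    (expDeriv 0)^[k] P = 0 := by
  have : expDeriv 0 = Polynomial.derivative := by
    ext1 Q
    simp [expDeriv]
  rw [this]
  exact Polynomial.iterate_derivative_eq_zero h

theorem contDiff_sum_eval_mul_exp {ι : Type*} (s : Finset ι) (P : ι → Polynomial ℝ)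
    (a : ι → ℝ) : ContDiff ℝ ⊤ fun x => ∑ i ∈ s, (P i).eval x * Real.exp (a i * x) := by
  refine ContDiff.sum fun i _ => ContDiff.mul ?_ (Real.contDiff_exp.comp (by fun_prop))
  simpa using (P i).contDiff_aeval (𝕜 := ℝ) ⊤

/-- A real exponential polynomial with `s.card` distinct frequencies and polynomial coefficients
of degree less than `T` cannot have `s.card * T` zeros: multiplying by an exponential turns one
frequency into `0`, and `T` derivatives remove it at the cost of `T` zeros. -/
theorem eq_zero_of_sum_eval_mul_exp_eq_zero {ι : Type*} [DecidableEq ι] (s : Finset ι) {T : ℕ}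
    (a : ι → ℝ) (P : ι → Polynomial ℝ) (ha : Set.InjOn a s) (hP : ∀ i ∈ s, (P i).natDegree < T)
    (Z : Finset ℝ) (hcard : s.card * T ≤ Z.card)
    (hZ : ∀ z ∈ Z, ∑ i ∈ s, (P i).eval z * Real.exp (a i * z) = 0) : ∀ i ∈ s, P i = 0 := by
  induction s using Finset.induction_on generalizing a P Z with
  | empty => simp
  | insert i₀ s hi₀ ih =>
    rw [Finset.card_insert_of_notMem hi₀, Nat.succ_mul] at hcard
    let b : ι → ℝ := fun i => a i - a i₀
    have hZb : ∀ z ∈ Z, ∑ i ∈ insert i₀ s, (P i).eval z * Real.exp (b i * z) = 0 := by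
      intro z hz
      have := congrArg (· * Real.exp (-(a i₀ * z))) (hZ z hz)
      simp only [zero_mul, Finset.sum_mul] at this
      rw [← this]
      refine Finset.sum_congr rfl fun i _ => ?_
      rw [mul_assoc, ← Real.exp_add]
      congr 2
      simp only [b]
      ring
    obtain ⟨lo, hlo⟩ := Z.bddBelow
    obtain ⟨hi, hhi⟩ := Z.bddAbove
    obtain ⟨Z', hZ'c, hZ', -⟩ := exists_finset_iteratedDeriv_eq_zero
      (contDiff_sum_eval_mul_exp (insert i₀ s) P b) Z hZb
      (fun z hz => ⟨hlo hz, hhi hz⟩) T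
    have hs : ∀ i ∈ s, P i = 0 := by
      have hne : ∀ i ∈ s, b i ≠ 0 := fun i hi h => by
        have : i = i₀ := ha (by simp [hi]) (by simp) (sub_eq_zero.1 h)
        exact hi₀ (this ▸ hi)
      have := ih b (fun i => (expDeriv (b i))^[T] (P i))
        (fun i hi j hj h => ha (by simpa using Or.inr hi) (by simpa using Or.inr hj)
          (sub_left_injective h))
        (fun i hi => (natDegree_expDeriv_iterate_le _ _ _).trans_lt (hP i (by simp [hi])))
        Z' (by omega) (by
          intro z hz
          have h := hZ' z hz
          rw [iteratedDeriv_sum_eval_mul_exp] at h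
          beta_reduce at h
          rw [Finset.sum_insert hi₀] at h
          have hb0 : b i₀ = 0 := sub_self _
          rw [hb0, expDeriv_zero_iterate_eq_zero (hP i₀ (by simp))] at h
          simpa using h)
      exact fun i hi => eq_zero_of_expDeriv_iterate_eq_zero (hne i hi) (this i hi)
    have h0 : P i₀ = 0 := by
      refine Polynomial.eq_zero_of_natDegree_lt_card_of_eval_eq_zero' (P i₀) Z ?_ ?_
      · intro z hz
        have h := hZ z hz
        rw [Finset.sum_insert hi₀, Finset.sum_eq_zero fun i hi => by rw [hs i hi]; simp,
          add_zero] at h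
        exact (mul_eq_zero.1 h).resolve_right (Real.exp_pos _).ne'
      · exact (hP i₀ (by simp)).trans_le (by omega)
    intro i hi
    rcases Finset.mem_insert.1 hi with rfl | hi
    · exact h0
    · exact hs i hi

/-- The functions `x ^ p * exp (q c x)` form a Chebyshev system on `ℝ`. -/
theorem det_pow_mul_exp_ne_zero {T₀ T₁ : ℕ} {p q : Fin (T₀ * T₁) → ℕ} (hp : ∀ r, p r < T₀)
    (hq : ∀ r, q r < T₁) (hpq : Function.Injective fun r => (p r, q r)) {c : ℝ} (hc : c ≠ 0)
    {x : Fin (T₀ * T₁) → ℝ} (hx : Function.Injective x) :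
    (Matrix.of fun r j => x j ^ p r * Real.exp (q r * c * x j)).det ≠ 0 := by
  intro hdet
  obtain ⟨v, hv0, hv⟩ := Matrix.exists_vecMul_eq_zero_iff.2 hdet
  refine hv0 (funext fun r₀ => ?_)
  have hT : 0 < T₀ := (Nat.zero_le _).trans_lt (hp r₀)
  -- the polynomial coefficient of `exp (l c x)` in the combination of the rows given by `v`
  let P : ℕ → Polynomial ℝ := fun l =>
    ∑ r, if q r = l then Polynomial.monomial (p r) (v r) else 0
  have hP := eq_zero_of_sum_eval_mul_exp_eq_zero (Finset.range T₁) (T := T₀)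
    (fun l => (l : ℝ) * c) P (by
      intro l _ l' _ h
      exact_mod_cast mul_right_cancel₀ hc h) (by
      intro l _
      have : (P l).natDegree ≤ T₀ - 1 := by
        refine Polynomial.natDegree_sum_le_of_forall_le _ _ fun r _ => ?_
        split_ifs
        · have := hp r
          exact (Polynomial.natDegree_monomial_le _).trans (by omega)
        · simp
      omega) (Finset.univ.image x) (by
      rw [Finset.card_image_of_injective _ hx]
      simp [mul_comm]) (by
      intro z hz
      obtain ⟨j, -, rfl⟩ := Finset.mem_image.1 hz
      have h := congrFun hv j
      simp only [Matrix.vecMul, dotProduct, Matrix.of_apply, Pi.zero_apply] at h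
      rw [← h]
      simp only [P, Polynomial.eval_finsetSum, Finset.sum_mul]
      rw [Finset.sum_comm]
      refine Finset.sum_congr rfl fun r _ => ?_
      rw [Finset.sum_eq_single (q r)]
      · simp [mul_assoc]
      · intro l _ hl
        simp [hl.symm]
      · intro h
        exact absurd (Finset.mem_range.2 (hq r)) h)
  have h0 := hP (q r₀) (Finset.mem_range.2 (hq r₀))
  have h1 := congrArg (Polynomial.coeff · (p r₀)) h0
  simp only [P, Polynomial.finsetSum_coeff, Polynomial.coeff_zero] at h1
  rw [Finset.sum_eq_single r₀] at h1
  · simpa using h1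
  · intro r _ hr
    split_ifs with h
    · rw [Polynomial.coeff_monomial, if_neg]
      intro h'
      exact hr (hpq (Prod.ext h' h))
    · simp
  · simp

/-- Leibniz' rule, with the binomial sum closed up again after estimating its terms. -/
theorem abs_iteratedDeriv_pow_mul_exp_le {p T : ℕ} (hp : p ≤ T) {a A R y : ℝ} (hR : 1 ≤ R)
    (ha : |a| ≤ A) (hy : |y| ≤ R) (k : ℕ) :
    |iteratedDeriv k (fun x => x ^ p * Real.exp (a * x)) y| ≤
      R ^ T * Real.exp (A * R) * (T / R + A) ^ k := by
  have hA : 0 ≤ A := (abs_nonneg a).trans ha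
  have hR0 : 0 < R := by linarith
  have h := iteratedDeriv_mul (n := k) (x := y) (f := fun x : ℝ => x ^ p)
    (g := fun x => Real.exp (a * x)) (by fun_prop) (by fun_prop)
  have h' : iteratedDeriv k (fun x => x ^ p * Real.exp (a * x)) y = _ := h
  rw [h', add_pow, Finset.mul_sum]
  refine (Finset.abs_sum_le_sum_abs _ _).trans (Finset.sum_le_sum fun m _ => ?_)
  rw [iteratedDeriv_pow, iteratedDeriv_exp_const_mul]
  have hexp : Real.exp (a * y) ≤ Real.exp (A * R) := by
    refine Real.exp_le_exp.2 ((le_abs_self _).trans ?_)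
    rw [abs_mul]
    gcongr
  have hpow : (p.descFactorial m : ℝ) * |y| ^ (p - m) ≤ R ^ T * (T / R) ^ m := by
    rcases lt_or_ge p m with h | h
    · rw [Nat.descFactorial_of_lt h]
      simp only [Nat.cast_zero, zero_mul]
      positivity
    · calc (p.descFactorial m : ℝ) * |y| ^ (p - m) ≤ (p : ℝ) ^ m * R ^ (p - m) := by
            gcongr
            exact_mod_cast Nat.descFactorial_le_pow p m
        _ = R ^ p * (p / R) ^ m := by
            rw [div_pow, ← Nat.sub_add_cancel h, pow_add]
            simp only [Nat.sub_add_cancel h]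
            field_simp
        _ ≤ R ^ T * (T / R) ^ m := by
            gcongr
  rw [abs_mul, abs_mul, abs_mul, abs_mul, Nat.abs_cast, Nat.abs_cast, abs_pow, abs_pow,
    Real.abs_exp]
  calc (k.choose m : ℝ) * (p.descFactorial m * |y| ^ (p - m)) *
        (|a| ^ (k - m) * Real.exp (a * y)) ≤
      (k.choose m : ℝ) * (R ^ T * (T / R) ^ m) * (A ^ (k - m) * Real.exp (A * R)) := by
        gcongr
    _ = _ := by ring

/-! ### The two bounds in Schneider's method -/

/-- Liouville's inequality for a determinant of algebraic integers. -/
theorem one_le_norm_det_mul_pow {K : Type*} [Field K] [NumberField K] {N : ℕ}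
    (M : Matrix (Fin N) (Fin N) K) (hM : ∀ i j, IsIntegral ℤ (M i j)) {H : ℝ}
    (hH : ∀ τ : K →+* ℂ, ∀ i j, ‖τ (M i j)‖ ≤ H) (hdet : M.det ≠ 0) (τ : K →+* ℂ) :
    1 ≤ ‖τ M.det‖ * (N.factorial * H ^ N) ^ (Module.finrank ℚ K - 1) := by
  have hint : IsIntegral ℤ (Algebra.norm ℚ M.det) :=
    Algebra.isIntegral_norm ℚ (IsIntegral.det hM)
  obtain ⟨z, hz⟩ := IsIntegrallyClosed.isIntegral_iff.1 hint
  have hz0 : z ≠ 0 := by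
    rintro rfl
    rw [map_zero] at hz
    exact Algebra.norm_ne_zero_iff.2 hdet hz.symm
  have h1 : (1 : ℝ) ≤ ‖Algebra.norm ℚ M.det‖ := by
    rw [← hz, eq_intCast, ← Rat.norm_cast_real, Rat.cast_intCast, Real.norm_eq_abs]
    exact_mod_cast Int.one_le_abs hz0
  have hhouse : house M.det ≤ N.factorial * H ^ N := by
    rw [house, pi_norm_le_iff_of_nonempty]
    intro φ
    rw [canonicalEmbedding.apply_at, RingHom.map_det]
    simpa using norm_det_le_factorial_mul_prod (φ.mapMatrix M) (fun _ => H) (fun i j => hH φ i j)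
  refine h1.trans ((norm_norm_le_norm_mul_house_pow M.det τ).trans ?_)
  gcongr
  exact house_nonneg _

theorem exists_nat_isIntegral_mul {K : Type*} [Field K] [NumberField K] (x : K) :
    ∃ b : ℕ, b ≠ 0 ∧ IsIntegral ℤ ((b : K) * x) := by
  have hx : IsAlgebraic ℤ x :=
    (IsFractionRing.isAlgebraic_iff ℤ ℚ K).2 (Algebra.IsAlgebraic.isAlgebraic x)
  obtain ⟨y, hy, h⟩ := hx.exists_integral_multiple
  refine ⟨y.natAbs, Int.natAbs_ne_zero.2 hy, ?_⟩
  rw [zsmul_eq_mul] at h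
  rcases Int.natAbs_eq y with h' | h'
  · rw [h'] at h
    simpa using h
  · rw [h'] at h
    have := h.neg
    simpa using this

/-- The source of the analytic gain: the product of the factors `exp (-k)` over `k < N` is
`exp (-N (N - 1) / 2)`, while the factors `exp (e X)` contribute only `exp (e X N)`. -/
theorem pow_div_factorial_le_exp_mul {X : ℝ} (hX : 0 ≤ X) (k : ℕ) :
    X ^ k / k.factorial ≤ Real.exp (Real.exp 1 * X) * Real.exp (-(k : ℝ)) := by
  have h := Real.pow_div_factorial_le_exp (Real.exp 1 * X) (by positivity) k
  have h2 : Real.exp (-(k : ℝ)) * Real.exp 1 ^ k = 1 := by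
    rw [← Real.exp_nat_mul, ← Real.exp_add]
    simp
  calc X ^ k / k.factorial = ((Real.exp 1 * X) ^ k / k.factorial) * Real.exp (-(k : ℝ)) := by
        rw [mul_pow]
        linear_combination (-(X ^ k / k.factorial)) * h2
    _ ≤ _ := by gcongr

theorem prod_exp_neg_range (N : ℕ) :
    ∏ k ∈ Finset.range N, Real.exp (-(k : ℝ)) = Real.exp (-(((N : ℝ) - 1) / 2)) ^ N := by
  rw [← Real.exp_sum, ← Real.exp_nat_mul, Finset.sum_neg_distrib]
  congr 1
  induction N with
  | zero => simp
  | succ n ih =>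
    rw [Finset.sum_range_succ, neg_add, ih]
    push_cast
    ring

/-- Upper bound for the interpolation determinant of the functions `x ^ p * exp (q c x)`. -/
theorem abs_det_pow_mul_exp_le {N T₀ T₁ : ℕ} {p q : Fin N → ℕ} (hp : ∀ r, p r < T₀)
    (hq : ∀ r, q r < T₁) {c : ℝ} {x : Fin N → ℝ} (hx : Function.Injective x) {R : ℝ}
    (hR : 1 ≤ R) (hxR : ∀ j, |x j| ≤ R) :
    |(Matrix.of fun r j => x j ^ p r * Real.exp (q r * c * x j)).det| ≤
      (N * (R ^ T₀ * Real.exp (T₁ * |c| * R)) *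
        Real.exp (Real.exp 1 * (2 * T₀ + 2 * (T₁ * |c| * R))) *
        Real.exp (-(((N : ℝ) - 1) / 2))) ^ N := by
  have hR0 : 0 < R := by linarith
  have h := abs_det_interpolation_le (N := N)
    (f := fun r y => y ^ p r * Real.exp (q r * c * y)) (fun r => by fun_prop) hx hxR
    (M := fun k => R ^ T₀ * Real.exp (T₁ * |c| * R) * (T₀ / R + T₁ * |c|) ^ k) (by
      intro r k y hy
      refine abs_iteratedDeriv_pow_mul_exp_le (hp r).le hR ?_ hy k
      rw [abs_mul, Nat.abs_cast]
      have : (q r : ℝ) ≤ T₁ := by exact_mod_cast (hq r).le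
      gcongr)
  refine h.trans ?_
  have hfac : (N.factorial : ℝ) ≤ (N : ℝ) ^ N := by exact_mod_cast Nat.factorial_le_pow N
  have hterm : ∀ k ∈ Finset.range N, (2 * R) ^ k *
      (R ^ T₀ * Real.exp (T₁ * |c| * R) * (T₀ / R + T₁ * |c|) ^ k / k.factorial) ≤
      R ^ T₀ * Real.exp (T₁ * |c| * R) *
        Real.exp (Real.exp 1 * (2 * T₀ + 2 * (T₁ * |c| * R))) * Real.exp (-(k : ℝ)) := by
    intro k _
    have h1 := pow_div_factorial_le_exp_mul (X := 2 * T₀ + 2 * (T₁ * |c| * R)) (by positivity) k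
    have h2 : (2 * R) ^ k * (T₀ / R + T₁ * |c|) ^ k = (2 * T₀ + 2 * (T₁ * |c| * R)) ^ k := by
      rw [← mul_pow]
      congr 1
      field_simp
    calc _ = R ^ T₀ * Real.exp (T₁ * |c| * R) *
          (((2 * R) ^ k * (T₀ / R + T₁ * |c|) ^ k) / k.factorial) := by ring
      _ ≤ R ^ T₀ * Real.exp (T₁ * |c| * R) *
          (Real.exp (Real.exp 1 * (2 * T₀ + 2 * (T₁ * |c| * R))) * Real.exp (-(k : ℝ))) := by
          rw [h2]
          gcongr
      _ = _ := by ring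
  calc _ ≤ (N : ℝ) ^ N * ∏ k ∈ Finset.range N, (R ^ T₀ * Real.exp (T₁ * |c| * R) *
        Real.exp (Real.exp 1 * (2 * T₀ + 2 * (T₁ * |c| * R))) * Real.exp (-(k : ℝ))) := by
        refine mul_le_mul hfac (Finset.prod_le_prod ?_ hterm)
          (Finset.prod_nonneg ?_) (by positivity)
        all_goals
          intro k _
          positivity
    _ = _ := by
        rw [Finset.prod_mul_distrib, prod_exp_neg_range, Finset.prod_const, Finset.card_range]
        simp only [mul_pow]
        ring

/-- The two bounds for the interpolation determinant of Schneider's method, put together: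
`T₀ T₁` functions `x ^ p * a ^ (q x)` are interpolated at the points `s + t β` with `s, t < S`. -/
theorem exp_le_of_schneider_parameters {K : Type*} [Field K] [NumberField K] (σ : K →+* ℝ)
    {a β g : K} (ha0 : 0 < σ a) (ha1 : σ a ≠ 1) (hβ : Irrational (σ β))
    (hg : σ g = Real.exp (σ β * Real.log (σ a))) {b : ℕ} (hb : b ≠ 0)
    (hba : IsIntegral ℤ ((b : K) * a)) (hbβ : IsIntegral ℤ ((b : K) * β))
    (hbg : IsIntegral ℤ ((b : K) * g)) {h : ℝ} (hbh : (b : ℝ) ≤ h)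
    (hah : ∀ τ : K →+* ℂ, ‖τ (b * a)‖ ≤ h) (hgh : ∀ τ : K →+* ℂ, ‖τ (b * g)‖ ≤ h)
    (hβh : ∀ τ : K →+* ℂ, b + ‖τ (b * β)‖ ≤ h) {T₀ T₁ S : ℕ} (hT₀ : 0 < T₀) (hT₁ : 0 < T₁)
    (hS : 0 < S) (hTS : T₀ * T₁ = S * S) :
    Real.exp ((((T₀ * T₁ : ℕ) : ℝ) - 1) / 2) ≤
      ((T₀ * T₁ : ℕ) : ℝ) * ((S * (1 + |σ β|)) ^ T₀ *
        Real.exp (T₁ * |Real.log (σ a)| * (S * (1 + |σ β|)))) *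
        Real.exp (Real.exp 1 * (2 * T₀ + 2 * (T₁ * |Real.log (σ a)| * (S * (1 + |σ β|))))) *
        (((T₀ * T₁ : ℕ) : ℝ) * ((h * S) ^ T₀ * h ^ (2 * (T₁ * S)))) ^ Module.finrank ℚ K := by
  set N := T₀ * T₁ with hN
  set c := Real.log (σ a) with hc
  set R := (S : ℝ) * (1 + |σ β|) with hRdef
  have hS1 : (1 : ℝ) ≤ S := by exact_mod_cast hS
  have hb1 : (1 : ℝ) ≤ b := by exact_mod_cast Nat.one_le_iff_ne_zero.2 hb
  have hh1 : 1 ≤ h := hb1.trans hbh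
  have hR1 : 1 ≤ R := by nlinarith [abs_nonneg (σ β)]
  have hc0 : c ≠ 0 := Real.log_ne_zero_of_pos_of_ne_one ha0 ha1
  have hN0 : N ≠ 0 := (Nat.mul_pos hT₀ hT₁).ne'
  let e₁ : Fin N ≃ Fin T₀ × Fin T₁ := finProdFinEquiv.symm
  let e₂ : Fin N ≃ Fin S × Fin S := (finCongr hTS).trans finProdFinEquiv.symm
  let p : Fin N → ℕ := fun r => (e₁ r).1
  let q : Fin N → ℕ := fun r => (e₁ r).2
  let s : Fin N → ℕ := fun r => (e₂ r).1
  let t : Fin N → ℕ := fun r => (e₂ r).2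
  have hp : ∀ r, p r < T₀ := fun r => (e₁ r).1.2
  have hq : ∀ r, q r < T₁ := fun r => (e₁ r).2.2
  have hs : ∀ r, s r < S := fun r => (e₂ r).1.2
  have ht : ∀ r, t r < S := fun r => (e₂ r).2.2
  have hpq : Function.Injective fun r => (p r, q r) := by
    intro r r' hr
    refine e₁.injective (Prod.ext ?_ ?_)
    · exact Fin.ext (Prod.ext_iff.1 hr).1
    · exact Fin.ext (Prod.ext_iff.1 hr).2
  let x : Fin N → ℝ := fun j => s j + t j * σ β
  have hx : Function.Injective x := by
    intro j j' hj
    have hj' : (s j : ℝ) + t j * σ β = s j' + t j' * σ β := hj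
    have htt : t j = t j' := by
      by_contra hne
      have hne' : ((t j : ℝ) - t j') ≠ 0 := sub_ne_zero.2 (by exact_mod_cast hne)
      refine hβ ⟨((s j' : ℚ) - s j) / (t j - t j'), ?_⟩
      push_cast
      rw [div_eq_iff hne']
      linarith
    have hss : s j = s j' := by
      rw [htt] at hj'
      exact_mod_cast add_right_cancel hj'
    exact e₂.injective (Prod.ext (Fin.ext hss) (Fin.ext htt))
  have hxR : ∀ j, |x j| ≤ R := by
    intro j
    have h1 : (s j : ℝ) ≤ S := by exact_mod_cast (hs j).le
    have h2 : (t j : ℝ) ≤ S := by exact_mod_cast (ht j).le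
    calc |x j| ≤ |(s j : ℝ)| + |t j * σ β| := abs_add_le _ _
      _ = s j + t j * |σ β| := by rw [abs_mul, Nat.abs_cast, Nat.abs_cast]
      _ ≤ S + S * |σ β| := by gcongr
      _ = R := by rw [hRdef]; ring
  let M : Matrix (Fin N) (Fin N) K := Matrix.of fun r j =>
    (s j + t j * β) ^ p r * (a ^ (q r * s j) * g ^ (q r * t j))
  have hMσ : σ.mapMatrix M = Matrix.of fun r j => x j ^ p r * Real.exp (q r * c * x j) := by
    ext r j
    have h1 : σ a = Real.exp c := (Real.exp_log ha0).symm
    simp only [M, x, RingHom.mapMatrix_apply, Matrix.map_apply, Matrix.of_apply, map_mul, map_pow,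
      map_add, map_natCast, hg, h1]
    rw [← Real.exp_nat_mul, ← Real.exp_nat_mul, ← Real.exp_add]
    congr 2
    push_cast
    ring
  let W : K := (b : K) ^ (T₀ + 2 * (T₁ * S))
  -- multiplication by `W` clears the denominators, the powers of `b` being distributed as needed
  have hsplit : ∀ r j, (W • M) r j = (b : K) ^ (T₀ - p r) * (b * s j + t j * (b * β)) ^ p r *
      ((b : K) ^ (T₁ * S - q r * s j) * (b * a) ^ (q r * s j)) *
      ((b : K) ^ (T₁ * S - q r * t j) * (b * g) ^ (q r * t j)) := by
    intro r j
    have h1 : (b : K) ^ T₀ = b ^ (T₀ - p r) * b ^ p r := by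
      rw [← pow_add, Nat.sub_add_cancel (hp r).le]
    have h2 : (b : K) ^ (T₁ * S) = b ^ (T₁ * S - q r * s j) * b ^ (q r * s j) := by
      rw [← pow_add, Nat.sub_add_cancel (Nat.mul_le_mul (hq r).le (hs j).le)]
    have h3 : (b : K) ^ (T₁ * S) = b ^ (T₁ * S - q r * t j) * b ^ (q r * t j) := by
      rw [← pow_add, Nat.sub_add_cancel (Nat.mul_le_mul (hq r).le (ht j).le)]
    have h4 : (b * s j + t j * (b * β) : K) = b * (s j + t j * β) := by ring
    have h5 : W = b ^ T₀ * (b ^ (T₁ * S) * b ^ (T₁ * S)) := by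
      simp only [W]
      rw [pow_add, two_mul, pow_add]
    rw [Matrix.smul_apply, smul_eq_mul, h5, h1, h4, mul_pow, mul_pow, mul_pow]
    nth_rewrite 1 [h2]
    rw [h3]
    simp only [M, Matrix.of_apply]
    ring
  have hnat : ∀ m : ℕ, IsIntegral ℤ (m : K) := fun m => by
    have := isIntegral_algebraMap (R := ℤ) (A := K) (x := (m : ℤ))
    simpa using this
  have hMint : ∀ r j, IsIntegral ℤ ((W • M) r j) := by
    intro r j
    rw [hsplit]
    exact (((hnat b).pow _).mul ((((hnat b).mul (hnat _)).add ((hnat _).mul hbβ)).pow _)).mul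
      (((hnat b).pow _).mul (hba.pow _)) |>.mul (((hnat b).pow _).mul (hbg.pow _))
  set H : ℝ := (h * S) ^ T₀ * h ^ (2 * (T₁ * S)) with hH
  have hMH : ∀ τ : K →+* ℂ, ∀ r j, ‖τ ((W • M) r j)‖ ≤ H := by
    intro τ r j
    have h1 : ‖τ (b * s j + t j * (b * β))‖ ≤ h * S := by
      have hs' : (s j : ℝ) ≤ S := by exact_mod_cast (hs j).le
      have ht' : (t j : ℝ) ≤ S := by exact_mod_cast (ht j).le
      rw [map_add, map_mul τ (t j : K)]
      refine (norm_add_le _ _).trans ?_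
      rw [map_mul τ (b : K) (s j), norm_mul, norm_mul, map_natCast, map_natCast, map_natCast,
        Complex.norm_natCast, Complex.norm_natCast, Complex.norm_natCast]
      calc (b : ℝ) * s j + t j * ‖τ (b * β)‖ ≤ b * S + S * ‖τ (b * β)‖ := by gcongr
        _ = (b + ‖τ (b * β)‖) * S := by ring
        _ ≤ h * S := by gcongr; exact hβh τ
    have hhS : 1 ≤ h * S := one_le_mul_of_one_le_of_one_le hh1 hS1
    have hbS : (b : ℝ) ≤ h * S := hbh.trans (le_mul_of_one_le_right (by linarith) hS1)
    rw [hsplit]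
    have hnorm : ∀ (B X A G : K) (i₁ i₂ i₃ i₄ i₅ i₆ : ℕ),
        ‖τ (B ^ i₁ * X ^ i₂ * (B ^ i₃ * A ^ i₄) * (B ^ i₅ * G ^ i₆))‖ =
        (‖τ B‖ ^ i₁ * ‖τ X‖ ^ i₂) * (‖τ B‖ ^ i₃ * ‖τ A‖ ^ i₄) * (‖τ B‖ ^ i₅ * ‖τ G‖ ^ i₆) := by
      intro B X A G i₁ i₂ i₃ i₄ i₅ i₆
      simp only [map_mul, map_pow, norm_mul, norm_pow]
    rw [hnorm, map_natCast, Complex.norm_natCast]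
    have hH' : H = ((h * S) ^ (T₀ - p r) * (h * S) ^ p r) *
        (h ^ (T₁ * S - q r * s j) * h ^ (q r * s j)) *
        (h ^ (T₁ * S - q r * t j) * h ^ (q r * t j)) := by
      rw [← pow_add, ← pow_add, ← pow_add, Nat.sub_add_cancel (hp r).le,
        Nat.sub_add_cancel (Nat.mul_le_mul (hq r).le (hs j).le),
        Nat.sub_add_cancel (Nat.mul_le_mul (hq r).le (ht j).le), hH]
      ring
    rw [hH']
    have h2 := hah τ
    have h3 := hgh τ
    gcongr
  have hσdet : σ M.det ≠ 0 := by
    rw [RingHom.map_det, hMσ]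
    exact det_pow_mul_exp_ne_zero hp hq hpq hc0 hx
  have hb0 : (b : K) ≠ 0 := by exact_mod_cast hb
  have hdet : (W • M).det ≠ 0 := by
    rw [Matrix.det_smul]
    exact mul_ne_zero (pow_ne_zero _ (pow_ne_zero _ hb0)) fun h0 => hσdet (by rw [h0, map_zero])
  have hL := one_le_norm_det_mul_pow (W • M) hMint hMH hdet ((algebraMap ℝ ℂ).comp σ)
  have hnorm : ‖((algebraMap ℝ ℂ).comp σ) (W • M).det‖ =
      ((b : ℝ) ^ (T₀ + 2 * (T₁ * S))) ^ N * |σ M.det| := by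
    rw [Matrix.det_smul]
    simp [W]
  rw [hnorm] at hL
  have hΔ := abs_det_pow_mul_exp_le hp hq hx hR1 hxR (c := c)
  rw [← hMσ, ← RingHom.map_det] at hΔ
  have hWH : (b : ℝ) ^ (T₀ + 2 * (T₁ * S)) ≤ H := by
    rw [hH, pow_add]
    have hbS : (b : ℝ) ≤ h * S := hbh.trans (le_mul_of_one_le_right (by linarith) hS1)
    gcongr
  have hfac : (N.factorial : ℝ) ≤ (N : ℝ) ^ N := by exact_mod_cast Nat.factorial_le_pow N
  have hN1 : (1 : ℝ) ≤ N := by exact_mod_cast Nat.one_le_iff_ne_zero.2 hN0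
  have hH0 : 0 ≤ H := by positivity
  set D := Module.finrank ℚ K with hD
  have hD0 : D ≠ 0 := Module.finrank_pos.ne'
  set U := (N : ℝ) * (R ^ T₀ * Real.exp (T₁ * |c| * R)) *
        Real.exp (Real.exp 1 * (2 * T₀ + 2 * (T₁ * |c| * R))) with hU
  have hbig : 1 ≤ (U * Real.exp (-(((N : ℝ) - 1) / 2)) * (N * H) ^ D) ^ N := by
    calc (1 : ℝ) ≤ _ := hL
      _ ≤ (H ^ N * (U * Real.exp (-(((N : ℝ) - 1) / 2))) ^ N) * ((N : ℝ) ^ N * H ^ N) ^ (D - 1) := by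
          gcongr
      _ = (U * Real.exp (-(((N : ℝ) - 1) / 2))) ^ N * (H ^ N * ((N * H) ^ N) ^ (D - 1)) := by
          rw [mul_pow (N : ℝ)]
          ring
      _ ≤ (U * Real.exp (-(((N : ℝ) - 1) / 2))) ^ N * ((N * H) ^ N * ((N * H) ^ N) ^ (D - 1)) := by
          have : H ≤ N * H := le_mul_of_one_le_left hH0 hN1
          gcongr
      _ = _ := by
          rw [← pow_succ', Nat.sub_add_cancel (Nat.one_le_iff_ne_zero.2 hD0), ← pow_mul,
            mul_comm N D, pow_mul _ D N, ← mul_pow]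
  have hbig' : 1 ≤ U * Real.exp (-(((N : ℝ) - 1) / 2)) * (N * H) ^ D := by
    by_contra hlt
    exact absurd hbig (not_le.2 (pow_lt_one₀ (by positivity) (not_le.1 hlt) hN0))
  calc Real.exp (((N : ℝ) - 1) / 2) = Real.exp (((N : ℝ) - 1) / 2) * 1 := (mul_one _).symm
    _ ≤ Real.exp (((N : ℝ) - 1) / 2) * (U * Real.exp (-(((N : ℝ) - 1) / 2)) * (N * H) ^ D) := by
        gcongr
    _ = (Real.exp (((N : ℝ) - 1) / 2) * Real.exp (-(((N : ℝ) - 1) / 2))) * (U * (N * H) ^ D) := by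
        ring
    _ = U * (N * H) ^ D := by
        rw [← Real.exp_add, add_neg_cancel, Real.exp_zero, one_mul]

/-! ### The real Gelfond–Schneider theorem -/

/-- The Gelfond–Schneider theorem in a number field with a real embedding `σ`: for `σ a > 0`,
`σ a ≠ 1`, the numbers `a`, `β` and `a ^ β` lie in the field only if `β` is rational. -/
theorem not_irrational_of_exp_mul_log {K : Type*} [Field K] [NumberField K] (σ : K →+* ℝ)
    {a β g : K} (ha0 : 0 < σ a) (ha1 : σ a ≠ 1)
    (hg : σ g = Real.exp (σ β * Real.log (σ a))) : ¬ Irrational (σ β) := by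
  intro hβ
  obtain ⟨b₁, hb₁, hi₁⟩ := exists_nat_isIntegral_mul a
  obtain ⟨b₂, hb₂, hi₂⟩ := exists_nat_isIntegral_mul β
  obtain ⟨b₃, hb₃, hi₃⟩ := exists_nat_isIntegral_mul g
  have hnat : ∀ m : ℕ, IsIntegral ℤ (m : K) := fun m => by
    have := isIntegral_algebraMap (R := ℤ) (A := K) (x := (m : ℤ))
    simpa using this
  obtain ⟨b, hb, hba, hbβ, hbg⟩ : ∃ b : ℕ, b ≠ 0 ∧ IsIntegral ℤ ((b : K) * a) ∧
      IsIntegral ℤ ((b : K) * β) ∧ IsIntegral ℤ ((b : K) * g) := by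
    refine ⟨b₁ * b₂ * b₃, by positivity, ?_, ?_, ?_⟩ <;> push_cast
    · rw [show (b₁ * b₂ * b₃ * a : K) = b₂ * b₃ * (b₁ * a) by ring]
      exact ((hnat b₂).mul (hnat b₃)).mul hi₁
    · rw [show (b₁ * b₂ * b₃ * β : K) = b₁ * b₃ * (b₂ * β) by ring]
      exact ((hnat b₁).mul (hnat b₃)).mul hi₂
    · rw [show (b₁ * b₂ * b₃ * g : K) = b₁ * b₂ * (b₃ * g) by ring]
      exact ((hnat b₁).mul (hnat b₂)).mul hi₃
  set h : ℝ := b + house (b * a : K) + house (b * β : K) + house (b * g : K) with hh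
  have hb1 : (1 : ℝ) ≤ b := by exact_mod_cast Nat.one_le_iff_ne_zero.2 hb
  have ha' := house_nonneg (b * a : K)
  have hβ' := house_nonneg (b * β : K)
  have hg' := house_nonneg (b * g : K)
  have hh1 : 1 ≤ h := by linarith
  set c := Real.log (σ a) with hc
  set ρ := 1 + |σ β| with hρ
  have hρ0 : 0 < ρ := by positivity
  have hρ1 : 1 ≤ ρ := by
    have := abs_nonneg (σ β)
    linarith
  set D := Module.finrank ℚ K with hD
  set C₁ : ℝ := 6 + 6 * D with hC₁
  set C₂ : ℝ := Real.log ρ + |c| * ρ + 2 * Real.exp 1 * (1 + |c| * ρ) + 3 * D * Real.log h with hC₂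
  have hC₁0 : 0 ≤ C₁ := by positivity
  have hC₂0 : 0 ≤ C₂ := by
    have h1 := Real.log_nonneg hρ1
    have h2 := Real.log_nonneg hh1
    positivity
  -- with `n = k²`, `S = n²`, `T₀ = n³`, `T₁ = n` the main terms are `n⁴` against `n³ log n`
  have key : ∀ k : ℕ, 2 ≤ k → (k : ℝ) ≤ 8 * C₁ + 4 * C₂ := by
    intro k hk
    set n : ℕ := k ^ 2 with hn
    have hk' : (2 : ℝ) ≤ k := by exact_mod_cast hk
    have hn' : (n : ℝ) = (k : ℝ) ^ 2 := by rw [hn]; push_cast; rfl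
    have hn4 : (4 : ℝ) ≤ n := by rw [hn']; nlinarith
    have hnpos : 0 < n := by positivity
    have hn0 : (0 : ℝ) < n := by positivity
    have hmain := exp_le_of_schneider_parameters σ ha0 ha1 hβ hg hb hba hbβ hbg (h := h)
      (by linarith) (fun τ => (norm_embedding_le_house _ τ).trans (by linarith))
      (fun τ => (norm_embedding_le_house _ τ).trans (by linarith))
      (fun τ => by linarith [norm_embedding_le_house (b * β : K) τ])
      (T₀ := n ^ 3) (T₁ := n) (S := n ^ 2) (by positivity) hnpos (by positivity) (by ring)
    have hlog := Real.log_le_log (Real.exp_pos _) hmain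
    have hNe : ((n ^ 3 * n : ℕ) : ℝ) = (n : ℝ) ^ 4 := by push_cast; ring
    rw [← hc, ← hρ, ← hD, hNe, Real.log_exp] at hlog
    have hh0 : 0 < h := by linarith
    rw [Real.log_mul (by positivity) (by positivity), Real.log_mul (by positivity) (by positivity),
      Real.log_mul (by positivity) (by positivity), Real.log_mul (by positivity) (by positivity),
      Real.log_exp, Real.log_exp, Real.log_pow _ D,
      Real.log_mul (by positivity) (by positivity), Real.log_mul (by positivity) (by positivity),
      Real.log_pow _ (n ^ 3), Real.log_pow _ (n ^ 3), Real.log_pow _ (2 * (n * n ^ 2)),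
      Real.log_mul (by positivity) (by positivity), Real.log_mul (by positivity) (by positivity)]
      at hlog
    push_cast at hlog
    rw [Real.log_pow, Real.log_pow] at hlog
    push_cast at hlog
    have hℓ : Real.log n ≤ 2 * k := by
      rw [hn', Real.log_pow]
      push_cast
      have := Real.log_le_self (show (0 : ℝ) ≤ k by positivity)
      linarith
    have hℓ0 : 0 ≤ Real.log n := Real.log_nonneg (by linarith)
    have hn3 : (1 : ℝ) ≤ (n : ℝ) ^ 3 := one_le_pow₀ (by linarith)
    have hℓ3 : Real.log n ≤ (n : ℝ) ^ 3 * Real.log n := le_mul_of_one_le_left hℓ0 hn3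
    have hup : ((n : ℝ) ^ 4 - 1) / 2 ≤ (n : ℝ) ^ 3 * (C₁ * Real.log n + C₂) := by
      refine hlog.trans ?_
      have hDℓ : (D : ℝ) * Real.log n ≤ D * ((n : ℝ) ^ 3 * Real.log n) := by gcongr
      rw [hC₁, hC₂]
      linarith
    have hlow : (n : ℝ) ^ 3 * (n / 4) ≤ ((n : ℝ) ^ 4 - 1) / 2 := by
      have : (1 : ℝ) ≤ (n : ℝ) ^ 4 / 2 := by
        have : (4 : ℝ) ^ 4 ≤ (n : ℝ) ^ 4 := by gcongr
        linarith
      linarith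
    have hdiv : (n : ℝ) / 4 ≤ C₁ * Real.log n + C₂ :=
      le_of_mul_le_mul_left (hlow.trans hup) (by positivity)
    have h1 : C₁ * Real.log n ≤ C₁ * (2 * k) := by gcongr
    have h2 : C₂ ≤ C₂ * k := le_mul_of_one_le_right hC₂0 (by linarith)
    have h3 : (n : ℝ) ≤ (8 * C₁ + 4 * C₂) * k := by linarith
    rw [hn', pow_two] at h3
    exact le_of_mul_le_mul_right h3 (by linarith)
  obtain ⟨k, hk⟩ := exists_nat_gt (8 * C₁ + 4 * C₂)
  have h1 := key (k + 2) (by omega)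
  push_cast at h1
  linarith

/-- The Gelfond–Schneider theorem for real logarithms: if the quotient of the logarithms of two
positive real algebraic numbers is algebraic, it is rational. -/
theorem not_irrational_log_div_log {a g : ℝ} (ha : 0 < a) (hg : 0 < g) (ha' : IsAlgebraic ℚ a)
    (hg' : IsAlgebraic ℚ g) (h : IsAlgebraic ℚ (Real.log g / Real.log a)) :
    ¬ Irrational (Real.log g / Real.log a) := by
  by_cases ha1 : a = 1
  · simp [ha1]
  set β := Real.log g / Real.log a with hβ
  let F : IntermediateField ℚ ℝ := IntermediateField.adjoin ℚ {a, β, g}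
  have hfin : FiniteDimensional ℚ F := by
    refine IntermediateField.finiteDimensional_adjoin ?_
    rintro x (rfl | rfl | rfl)
    exacts [ha'.isIntegral, h.isIntegral, hg'.isIntegral]
  have : NumberField F := ⟨⟩
  have hsub := IntermediateField.subset_adjoin ℚ ({a, β, g} : Set ℝ)
  have haF : a ∈ F := hsub (by simp)
  have hβF : β ∈ F := hsub (by simp)
  have hgF : g ∈ F := hsub (by simp)
  have hloga : Real.log a ≠ 0 := Real.log_ne_zero_of_pos_of_ne_one ha ha1
  refine not_irrational_of_exp_mul_log (algebraMap F ℝ) (a := ⟨a, haF⟩) (β := ⟨β, hβF⟩)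
    (g := ⟨g, hgF⟩) ha ha1 ?_
  change g = Real.exp (β * Real.log a)
  rw [hβ, div_mul_cancel₀ _ hloga, Real.exp_log hg]

/-! ### Shapes of plane lattices -/

theorem mem_planeLattice {z : ℍ} {v : ℂ} :
    v ∈ planeLattice z ↔ ∃ m n : ℤ, v = m + n * (z : ℂ) := by
  rw [planeLattice, AddSubgroup.mem_closure_pair]
  simp [eq_comm]

theorem norm_sq_add_mul (z : ℍ) (m n : ℝ) :
    ‖(m + n * (z : ℂ) : ℂ)‖ ^ 2 =
      m ^ 2 + 2 * m * n * z.re + n ^ 2 * (z.re ^ 2 + z.im ^ 2) := by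
  rw [← Complex.normSq_eq_norm_sq, Complex.normSq_apply]
  simp
  ring

theorem norm_coe_sq (z : ℍ) : ‖(z : ℂ)‖ ^ 2 = z.re ^ 2 + z.im ^ 2 := by
  simpa using norm_sq_add_mul z 0 1

theorem one_le_norm_of_mem_stdDomain {z : ℍ} (hz : z ∈ stdDomain) : 1 ≤ ‖(z : ℂ)‖ := by
  have h := hz.2.2
  rw [← norm_coe_sq] at h
  nlinarith [norm_nonneg (z : ℂ)]

/-- A point `z` of the standard domain is a shortest vector of `ℤ + ℤ z` outside of `ℤ`. -/
theorem norm_coe_le_norm_add_mul {z : ℍ} (hz : z ∈ stdDomain) (m n : ℤ) (hn : n ≠ 0) :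
    ‖(z : ℂ)‖ ≤ ‖(m + n * (z : ℂ) : ℂ)‖ := by
  refine (sq_le_sq₀ (norm_nonneg _) (norm_nonneg _)).1 ?_
  have h := norm_sq_add_mul z m n
  rw [Complex.ofReal_intCast, Complex.ofReal_intCast] at h
  rw [h, norm_coe_sq]
  obtain ⟨h0, h1, h2⟩ := hz
  set Q := z.re ^ 2 + z.im ^ 2 with hQ
  have hn1 : (1 : ℝ) ≤ (n : ℝ) ^ 2 := by
    have : (1 : ℤ) ≤ n ^ 2 := (one_le_sq_iff_one_le_abs _).2 (Int.one_le_abs hn)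
    exact_mod_cast this
  have hint : (0 : ℝ) ≤ (m : ℝ) ^ 2 - |(m : ℝ) * n| + ((n : ℝ) ^ 2 - 1) := by
    have : (0 : ℤ) ≤ m ^ 2 - |m * n| + (n ^ 2 - 1) := by
      rw [abs_mul, ← sq_abs m, ← sq_abs n]
      have h3 := Int.one_le_abs hn
      have h4 := abs_nonneg m
      generalize |m| = a at *
      generalize |n| = b at *
      rcases h3.eq_or_lt with rfl | h3
      · rcases h4.eq_or_lt with rfl | h4
        · simp
        · nlinarith
      · nlinarith [sq_nonneg (2 * a - b)]
    exact_mod_cast this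
  have habs : -|(m : ℝ) * n| ≤ 2 * m * n * z.re := by
    have h5 := neg_abs_le ((m : ℝ) * n)
    have h6 := abs_nonneg ((m : ℝ) * n)
    nlinarith
  nlinarith [mul_nonneg (sub_nonneg.2 hn1) (sub_nonneg.2 h2)]

theorem one_le_norm_of_mem_planeLattice {z : ℍ} (hz : z ∈ stdDomain) {v : ℂ}
    (hv : v ∈ planeLattice z) (hv0 : v ≠ 0) : 1 ≤ ‖v‖ := by
  obtain ⟨m, n, rfl⟩ := mem_planeLattice.1 hv
  by_cases hn : n = 0
  · subst hn
    have hm : m ≠ 0 := by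
      rintro rfl
      simp at hv0
    simpa using (by exact_mod_cast Int.one_le_abs hm : (1 : ℝ) ≤ |(m : ℝ)|)
  · exact (one_le_norm_of_mem_stdDomain hz).trans (norm_coe_le_norm_add_mul hz m n hn)

/-- An isometry of plane lattices preserves the second minimum and the covolume; one inequality
for each of them. -/
theorem norm_le_and_im_le_of_isometry {p q : ℍ} (hp : p ∈ stdDomain) (hq : q ∈ stdDomain)
    (f : planeLattice p →+ planeLattice q) (hf : ∀ x, ‖f x‖ = ‖x‖) :
    ‖(q : ℂ)‖ ≤ ‖(p : ℂ)‖ ∧ q.im ≤ p.im := by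
  let u₁ : planeLattice p := ⟨1, mem_planeLattice.2 ⟨1, 0, by simp⟩⟩
  let u₂ : planeLattice p := ⟨p, mem_planeLattice.2 ⟨0, 1, by simp⟩⟩
  obtain ⟨m, n, h₁⟩ := mem_planeLattice.1 (f u₁).2
  obtain ⟨m', n', h₂⟩ := mem_planeLattice.1 (f u₂).2
  have e₁ : ‖(m + n * (q : ℂ) : ℂ)‖ = 1 := by
    rw [← h₁]
    simpa [u₁] using hf u₁
  have e₂ : ‖(m' + n' * (q : ℂ) : ℂ)‖ = ‖(p : ℂ)‖ := by
    rw [← h₂]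
    exact hf u₂
  have e₃ : ‖((m + m' : ℤ) + (n + n' : ℤ) * (q : ℂ) : ℂ)‖ = ‖(1 + p : ℂ)‖ := by
    have : ((f (u₁ + u₂) : planeLattice q) : ℂ) = (m + m' : ℤ) + (n + n' : ℤ) * (q : ℂ) := by
      rw [map_add, AddSubgroup.coe_add, h₁, h₂]
      push_cast
      ring
    rw [← this]
    exact hf (u₁ + u₂)
  have g₁ := norm_sq_add_mul q m n
  have g₂ := norm_sq_add_mul q m' n'
  have g₃ := norm_sq_add_mul q (m + m' : ℤ) (n + n' : ℤ)
  have g₄ := norm_sq_add_mul p 1 1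
  simp only [Complex.ofReal_intCast, Complex.ofReal_one, one_mul] at g₁ g₂ g₃ g₄
  rw [e₁] at g₁
  rw [e₂, norm_coe_sq] at g₂
  rw [e₃, g₄] at g₃
  push_cast at g₃
  have hinner : (m : ℝ) * m' + (m * n' + m' * n) * q.re + n * n' * (q.re ^ 2 + q.im ^ 2) = p.re := by
    linarith
  -- the Gram determinant of the images of `1` and `p` is the square of an integer times that of `q`
  have hgram : ((m : ℝ) * n' - m' * n) ^ 2 * q.im ^ 2 = p.im ^ 2 := by
    linear_combination (-1 : ℝ) * (p.re ^ 2 + p.im ^ 2) * g₁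
      - ((m : ℝ) ^ 2 + 2 * m * n * q.re + n ^ 2 * (q.re ^ 2 + q.im ^ 2)) * g₂
      - ((m : ℝ) * m' + (m * n' + m' * n) * q.re + n * n' * (q.re ^ 2 + q.im ^ 2) + p.re) * hinner
  have hD : m * n' - m' * n ≠ 0 := by
    intro h
    have h' : (m : ℝ) * n' - m' * n = 0 := by exact_mod_cast h
    rw [h'] at hgram
    have := p.im_pos
    nlinarith
  constructor
  · by_cases hn : n = 0
    · have hn' : n' ≠ 0 := by
        rintro rfl
        simp [hn] at hD
      rw [← e₂]
      exact norm_coe_le_norm_add_mul hq m' n' hn'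
    · refine (norm_coe_le_norm_add_mul hq m n hn).trans ?_
      rw [e₁]
      exact one_le_norm_of_mem_stdDomain hp
  · refine (sq_le_sq₀ q.im_pos.le p.im_pos.le).1 ?_
    rw [← hgram]
    refine le_mul_of_one_le_left (sq_nonneg _) ?_
    have : (1 : ℤ) ≤ (m * n' - m' * n) ^ 2 := (one_le_sq_iff_one_le_abs _).2 (Int.one_le_abs hD)
    exact_mod_cast this

/-- The standard domain contains at most one point from every similarity class of lattices. -/
theorem eq_of_planeLattice_similar {p q : ℍ} (hp : p ∈ stdDomain) (hq : q ∈ stdDomain)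
    (f : planeLattice p ≃+ planeLattice q) {c : ℝ} (hc : 0 < c) (hf : ∀ x, ‖f x‖ = c * ‖x‖) :
    p = q := by
  -- both lattices have shortest nonzero vectors of length `1`
  have hc1 : c = 1 := by
    apply le_antisymm
    · let u : planeLattice q := ⟨1, mem_planeLattice.2 ⟨1, 0, by simp⟩⟩
      have hu : ‖u‖ = 1 := by simp [u]
      have h := hf (f.symm u)
      rw [f.apply_symm_apply, hu] at h
      have h0 : ((f.symm u : planeLattice p) : ℂ) ≠ 0 := by
        intro h0
        have h0' : ‖f.symm u‖ = 0 := norm_eq_zero.2 (Subtype.ext h0)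
        rw [h0', mul_zero] at h
        exact one_ne_zero h
      have h1 : 1 ≤ ‖f.symm u‖ := one_le_norm_of_mem_planeLattice hp (f.symm u).2 h0
      nlinarith
    · let u : planeLattice p := ⟨1, mem_planeLattice.2 ⟨1, 0, by simp⟩⟩
      have hu : ‖u‖ = 1 := by simp [u]
      have h := hf u
      rw [hu, mul_one] at h
      rw [← h]
      refine one_le_norm_of_mem_planeLattice hq (f u).2 fun h0 => ?_
      have h0' : ‖f u‖ = 0 := norm_eq_zero.2 (Subtype.ext h0)
      linarith
  simp only [hc1, one_mul] at hf
  obtain ⟨h1, h2⟩ := norm_le_and_im_le_of_isometry hp hq f.toAddMonoidHom hf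
  obtain ⟨h3, h4⟩ := norm_le_and_im_le_of_isometry hq hp f.symm.toAddMonoidHom (fun x => by
    have := hf (f.symm x)
    rw [f.apply_symm_apply] at this
    exact this.symm)
  have him : p.im = q.im := le_antisymm h4 h2
  have hn : ‖(p : ℂ)‖ ^ 2 = ‖(q : ℂ)‖ ^ 2 := by rw [le_antisymm h3 h1]
  rw [norm_coe_sq, norm_coe_sq, him, add_left_inj] at hn
  have hre : p.re = q.re := (sq_eq_sq₀ hp.1 hq.1).1 hn
  exact UpperHalfPlane.ext (Complex.ext hre him)

section Similarity

variable {E : Type*} [NormedAddCommGroup E] [InnerProductSpace ℝ E]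

/-- The lattice spanned by two vectors is similar to the plane lattice with the same Gram matrix up
to scaling. -/
theorem exists_addEquiv_closure_pair {v w : E} (z : ℍ) (hv : v ≠ 0)
    (hw : ‖w‖ ^ 2 = (z.re ^ 2 + z.im ^ 2) * ‖v‖ ^ 2) (hvw : inner ℝ v w = z.re * ‖v‖ ^ 2) :
    ∃ f : planeLattice z ≃+ AddSubgroup.closure {v, w}, ∀ x, ‖f x‖ = ‖v‖ * ‖x‖ := by
  have hy : z.im ≠ 0 := z.im_pos.ne'
  -- the real linear map with `1 ↦ v` and `z ↦ w`
  let T : ℂ →+ E :=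
    { toFun := fun ζ => (ζ.re - ζ.im * (z.re / z.im)) • v + (ζ.im / z.im) • w
      map_zero' := by simp
      map_add' := fun ζ ξ => by
        simp only [Complex.add_re, Complex.add_im]
        module }
  have hT : ∀ ζ, ‖T ζ‖ = ‖v‖ * ‖ζ‖ := by
    intro ζ
    refine (sq_eq_sq₀ (norm_nonneg _) (by positivity)).1 ?_
    change ‖(ζ.re - ζ.im * (z.re / z.im)) • v + (ζ.im / z.im) • w‖ ^ 2 = _
    rw [norm_add_sq_real, norm_smul, norm_smul, real_inner_smul_left, real_inner_smul_right, hvw,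
      mul_pow, mul_pow, hw, mul_pow, ← Complex.normSq_eq_norm_sq, Complex.normSq_apply,
      Real.norm_eq_abs, Real.norm_eq_abs, sq_abs, sq_abs]
    field_simp
    ring
  have hinj : Function.Injective T := by
    refine (injective_iff_map_eq_zero T).2 fun ζ hζ => ?_
    have h := hT ζ
    rw [hζ, norm_zero, eq_comm, mul_eq_zero] at h
    exact norm_eq_zero.1 (h.resolve_left (norm_ne_zero_iff.2 hv))
  have h1 : T 1 = v := by simp [T]
  have h2 : T z = w := by
    have h0 : z.re - z.im * (z.re / z.im) = 0 := by
      field_simp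
      ring
    simp [T, hy, h0]
  have himg : (planeLattice z).map T = AddSubgroup.closure {v, w} := by
    rw [planeLattice, AddMonoidHom.map_closure, Set.image_pair, h1, h2]
  refine ⟨((planeLattice z).equivMapOfInjective T hinj).trans (AddEquiv.addSubgroupCongr himg),
    fun x => ?_⟩
  exact hT x

theorem closure_pair_eq_of_mem {G : Type*} [AddCommGroup G] {a b c d : G} (ha : a ∈ AddSubgroup.closure {c, d})
    (hb : b ∈ AddSubgroup.closure {c, d}) (hc : c ∈ AddSubgroup.closure {a, b})
    (hd : d ∈ AddSubgroup.closure {a, b}) :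
    AddSubgroup.closure {a, b} = AddSubgroup.closure {c, d} := by
  apply le_antisymm <;> rw [AddSubgroup.closure_le]
  · rintro x (rfl | rfl)
    exacts [ha, hb]
  · rintro x (rfl | rfl)
    exacts [hc, hd]

theorem transcendental_ofReal {r : ℝ} (hr : Transcendental ℚ r) : Transcendental ℚ (r : ℂ) :=
  (transcendental_algebraMap_iff (algebraMap ℝ ℂ).injective).2 hr

theorem isAlgebraic_I : IsAlgebraic ℚ Complex.I :=
  ((Complex.isIntegral_rat_I : IsIntegral ℚ Complex.I)).isAlgebraic

/-- The three boundary curves of the standard domain. -/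
def OnBoundary (p : ℍ) : Prop :=
  (p.re = 0 ∧ 1 ≤ p.im) ∨
    (p.re ^ 2 + p.im ^ 2 = 1 ∧ 0 ≤ p.re ∧ p.re ≤ 1 / 2 ∧ 0 < p.im) ∨
    (p.re = 1 / 2 ∧ Real.sqrt 3 / 2 ≤ p.im)

theorem exists_boundary_point_of_orthogonal_of_norm_le {e f : E} (he : e ≠ 0)
    (hef : inner ℝ e f = 0) (hle : ‖e‖ ≤ ‖f‖) (Λ : AddSubgroup E)
    (hΛ : Λ = AddSubgroup.closure {e, f} ∨
      Λ = AddSubgroup.closure {(1 / 2 : ℝ) • (e + f), (1 / 2 : ℝ) • (f - e)})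
    (htr : Transcendental ℚ (‖f‖ / ‖e‖)) :
    ∃ p : ℍ, p ∈ stdDomain ∧ OnBoundary p ∧ Transcendental ℚ (p : ℂ) ∧
      ∃ (g : planeLattice p ≃+ Λ) (c : ℝ), 0 < c ∧ ∀ x, ‖g x‖ = c * ‖x‖ := by
  have he0 : 0 < ‖e‖ := norm_pos_iff.2 he
  set r := ‖f‖ / ‖e‖ with hr
  have hfr : ‖f‖ = r * ‖e‖ := by rw [hr, div_mul_cancel₀ _ he0.ne']
  have hr1 : 1 ≤ r := (one_le_div he0).2 hle
  have hr0 : 0 < r := by linarith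
  have hrC := transcendental_ofReal htr
  have hfe : inner ℝ f e = 0 := by rw [real_inner_comm, hef]
  have hsum : ‖(1 / 2 : ℝ) • (e + f)‖ ^ 2 = (1 + r ^ 2) / 4 * ‖e‖ ^ 2 := by
    rw [norm_smul, mul_pow, norm_add_sq_real, hef, hfr]
    norm_num
    ring
  have hdiff : ‖(1 / 2 : ℝ) • (f - e)‖ ^ 2 = (1 + r ^ 2) / 4 * ‖e‖ ^ 2 := by
    rw [norm_smul, mul_pow, norm_sub_sq_real, hfe, hfr]
    norm_num
    ring
  rcases hΛ with rfl | rfl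
  · -- rectangular lattice
    let p : ℍ := ⟨⟨0, r⟩, hr0⟩
    have hre : p.re = 0 := rfl
    have him : p.im = r := rfl
    refine ⟨p, ⟨by rw [hre], by rw [hre]; norm_num, by rw [hre, him]; nlinarith⟩,
      Or.inl ⟨hre, by rw [him]; exact hr1⟩, fun halg => hrC ?_, ?_⟩
    · have h : (r : ℂ) = -(p : ℂ) * Complex.I := by
        apply Complex.ext <;> simp [hre, him]
      rw [h]
      exact halg.neg.mul isAlgebraic_I
    · obtain ⟨g, hg⟩ := exists_addEquiv_closure_pair (v := e) (w := f) p he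
        (by rw [hre, him, hfr]; ring) (by rw [hre, hef]; ring)
      exact ⟨g, ‖e‖, he0, hg⟩
  · rcases le_or_gt 3 (r ^ 2) with h3 | h3
    · -- rhombic lattice, one diagonal of the rhombus is a shortest vector
      let p : ℍ := ⟨⟨1 / 2, r / 2⟩, by change 0 < r / 2; positivity⟩
      have hre : p.re = 1 / 2 := rfl
      have him : p.im = r / 2 := rfl
      refine ⟨p, ⟨by rw [hre]; norm_num, by rw [hre], by rw [hre, him]; nlinarith⟩,
        Or.inr (Or.inr ⟨hre, ?_⟩), fun halg => hrC ?_, ?_⟩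
      · rw [him]
        have := Real.sqrt_le_sqrt h3
        rw [Real.sqrt_sq hr0.le] at this
        linarith
      · have h : (r : ℂ) = -((p : ℂ) + p - 1) * Complex.I := by
          apply Complex.ext <;> simp [hre, him]
          norm_num
        rw [h]
        exact ((halg.add halg).sub (isAlgebraic_one)).neg.mul isAlgebraic_I
      · obtain ⟨g, hg⟩ := exists_addEquiv_closure_pair (v := e) (w := (1 / 2 : ℝ) • (e + f)) p he
          (by rw [hre, him, hsum]; ring) (by
            rw [hre, real_inner_smul_right, inner_add_right, hef, real_inner_self_eq_norm_sq]
            ring)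
        have hcl : AddSubgroup.closure {e, (1 / 2 : ℝ) • (e + f)} =
            AddSubgroup.closure {(1 / 2 : ℝ) • (e + f), (1 / 2 : ℝ) • (f - e)} := by
          refine closure_pair_eq_of_mem ?_ ?_ ?_ ?_ <;> rw [AddSubgroup.mem_closure_pair]
          · exact ⟨1, -1, by module⟩
          · exact ⟨1, 0, by module⟩
          · exact ⟨0, 1, by module⟩
          · exact ⟨-1, 1, by module⟩
        exact ⟨g.trans (AddEquiv.addSubgroupCongr hcl), ‖e‖, he0, hg⟩
    · -- rhombic lattice, the sides of the rhombus are shortest vectors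
      have hden : 0 < r ^ 2 + 1 := by positivity
      let p : ℍ := ⟨⟨(r ^ 2 - 1) / (r ^ 2 + 1), 2 * r / (r ^ 2 + 1)⟩, by
        change 0 < 2 * r / (r ^ 2 + 1); positivity⟩
      have hre : p.re = (r ^ 2 - 1) / (r ^ 2 + 1) := rfl
      have him : p.im = 2 * r / (r ^ 2 + 1) := rfl
      have hre0 : 0 ≤ p.re := by
        rw [hre]
        exact div_nonneg (by nlinarith) hden.le
      have hre1 : p.re ≤ 1 / 2 := by
        rw [hre, div_le_iff₀ hden]
        linarith
      have hcirc : p.re ^ 2 + p.im ^ 2 = 1 := by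
        rw [hre, him]
        field_simp
        ring
      refine ⟨p, ⟨hre0, hre1, hcirc.ge⟩, Or.inr (Or.inl ⟨hcirc, hre0, hre1, p.im_pos⟩),
        fun halg => hrC ?_, ?_⟩
      · have hp1 : (p : ℂ) - 1 ≠ 0 := by
          intro h
          have := congrArg Complex.im h
          simp at this
          exact p.im_pos.ne' this
        have h : (r : ℂ) * ((p : ℂ) - 1) = Complex.I * ((p : ℂ) + 1) := by
          apply Complex.ext <;> simp [hre, him]
          · field_simp
            ring
          · field_simp
            ring
        rw [← eq_div_iff hp1] at h
        rw [h, div_eq_mul_inv]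
        exact (isAlgebraic_I.mul (halg.add isAlgebraic_one)).mul (halg.sub isAlgebraic_one).inv
      · have hv : (1 / 2 : ℝ) • (e + f) ≠ 0 := by
          intro h
          rw [h, norm_zero] at hsum
          have : 0 < (1 + r ^ 2) / 4 * ‖e‖ ^ 2 := by positivity
          linarith
        obtain ⟨g, hg⟩ := exists_addEquiv_closure_pair (v := (1 / 2 : ℝ) • (e + f))
          (w := (1 / 2 : ℝ) • (f - e)) p hv (by rw [hcirc, hdiff, hsum, one_mul]) (by
            rw [hre, hsum, real_inner_smul_right, real_inner_smul_left, inner_add_left,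
              inner_sub_right, inner_sub_right, hef, hfe, real_inner_self_eq_norm_sq,
              real_inner_self_eq_norm_sq, hfr]
            field_simp
            ring)
        exact ⟨g, _, norm_pos_iff.2 hv, hg⟩

/-- A lattice with two orthogonal vectors `e`, `f` which generate it, or whose half sum and half
difference generate it, has its shape on the boundary of the standard domain; the shape is
transcendental when the ratio of the two lengths is. -/
theorem exists_boundary_point_of_orthogonal {e f : E} (he : e ≠ 0) (hf : f ≠ 0)
    (hef : inner ℝ e f = 0) (Λ : AddSubgroup E)
    (hΛ : Λ = AddSubgroup.closure {e, f} ∨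
      Λ = AddSubgroup.closure {(1 / 2 : ℝ) • (e + f), (1 / 2 : ℝ) • (f - e)})
    (htr : Transcendental ℚ (‖f‖ / ‖e‖)) :
    ∃ p : ℍ, p ∈ stdDomain ∧ OnBoundary p ∧ Transcendental ℚ (p : ℂ) ∧
      ∃ (g : planeLattice p ≃+ Λ) (c : ℝ), 0 < c ∧ ∀ x, ‖g x‖ = c * ‖x‖ := by
  rcases le_total ‖e‖ ‖f‖ with h | h
  · exact exists_boundary_point_of_orthogonal_of_norm_le he hef h Λ hΛ htr
  · refine exists_boundary_point_of_orthogonal_of_norm_le hf (by rw [real_inner_comm, hef]) h Λ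
      ?_ fun halg => htr ?_
    · rcases hΛ with rfl | rfl
      · exact Or.inl (by rw [Set.pair_comm])
      · refine Or.inr (closure_pair_eq_of_mem ?_ ?_ ?_ ?_) <;> rw [AddSubgroup.mem_closure_pair]
        · exact ⟨1, 0, by module⟩
        · exact ⟨0, -1, by module⟩
        · exact ⟨1, 0, by module⟩
        · exact ⟨0, -1, by module⟩
    · rw [← inv_div]
      exact halg.inv

end Similarity

/-! ### The unit lattice and automorphisms of the field -/

section Dichotomy

variable {E : Type*} [AddCommGroup E] [Module ℝ E]

/-- A lattice with an involution whose fixed and antifixed parts are generated by `v` and `v'` is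
either spanned by `v` and `v'` or contains this span with index two, the other coset being that of
`(v + v') / 2`. -/
theorem eq_closure_or_eq_closure_half (Λ : AddSubgroup E) (R : E →ₗ[ℝ] E)
    (hR : ∀ x ∈ Λ, R x ∈ Λ) (hRR : ∀ x, R (R x) = x) {v v' : E} (hv0 : v ≠ 0)
    (hv : v ∈ Λ) (hv' : v' ∈ Λ) (hRv : R v = v) (hRv' : R v' = -v')
    (hfix : ∀ x ∈ Λ, R x = x → ∃ a : ℤ, x = a • v)
    (hanti : ∀ x ∈ Λ, R x = -x → ∃ a : ℤ, x = a • v') :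
    Λ = AddSubgroup.closure {v, v'} ∨
      Λ = AddSubgroup.closure {(1 / 2 : ℝ) • (v + v'), (1 / 2 : ℝ) • (v' - v)} := by
  have hsplit : ∀ x ∈ Λ, ∃ a b : ℤ, x + R x = a • v ∧ x - R x = b • v' := by
    intro x hx
    obtain ⟨a, ha⟩ := hfix (x + R x) (Λ.add_mem hx (hR x hx)) (by rw [map_add, hRR, add_comm])
    obtain ⟨b, hb⟩ := hanti (x - R x) (Λ.sub_mem hx (hR x hx)) (by rw [map_sub, hRR, neg_sub])
    exact ⟨a, b, ha, hb⟩
  have hhalf : ∀ (x : E) (a b : ℤ), x + R x = a • v → x - R x = b • v' →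
      x = ((a : ℝ) / 2) • v + ((b : ℝ) / 2) • v' := by
    intro x a b ha hb
    have h2 : (2 : ℝ) • x = (a : ℝ) • v + (b : ℝ) • v' := by
      rw [Int.cast_smul_eq_zsmul, Int.cast_smul_eq_zsmul, ← ha, ← hb]
      module
    have h3 : x = (1 / 2 : ℝ) • ((2 : ℝ) • x) := by module
    rw [h3, h2]
    module
  -- the two integers in `hhalf` have the same parity, and both can be odd only if `(v + v') / 2 ∈ Λ`
  by_cases hw : (1 / 2 : ℝ) • (v + v') ∈ Λ
  · right
    have hw' : (1 / 2 : ℝ) • (v' - v) ∈ Λ := by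
      have h : (1 / 2 : ℝ) • (v' - v) = (1 / 2 : ℝ) • (v + v') - v := by module
      rw [h]
      exact Λ.sub_mem hw hv
    apply le_antisymm
    · intro x hx
      obtain ⟨a, b, ha, hb⟩ := hsplit x hx
      have hxe := hhalf x a b ha hb
      have hy : x - a • ((1 / 2 : ℝ) • (v + v')) = (((b : ℝ) - a) / 2) • v' := by
        rw [hxe, ← Int.cast_smul_eq_zsmul ℝ]
        module
      obtain ⟨k, hk⟩ := hanti _ (Λ.sub_mem hx (Λ.zsmul_mem hw a)) (by
        rw [hy, map_smul, hRv', smul_neg])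
      rw [AddSubgroup.mem_closure_pair]
      refine ⟨a + k, k, ?_⟩
      rw [sub_eq_iff_eq_add] at hk
      rw [hk, ← Int.cast_smul_eq_zsmul ℝ, ← Int.cast_smul_eq_zsmul ℝ, ← Int.cast_smul_eq_zsmul ℝ,
        ← Int.cast_smul_eq_zsmul ℝ]
      push_cast
      module
    · rw [AddSubgroup.closure_le]
      rintro x (rfl | rfl)
      exacts [hw, hw']
  · left
    apply le_antisymm
    · intro x hx
      obtain ⟨a, b, ha, hb⟩ := hsplit x hx
      have hxe := hhalf x a b ha hb
      have haeven : Even a := by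
        by_contra hodd
        obtain ⟨a', rfl⟩ := Int.not_even_iff_odd.1 hodd
        rcases Int.even_or_odd' b with ⟨b', rfl | rfl⟩
        · have hy : x - b' • v' = (((2 * a' + 1 : ℤ) : ℝ) / 2) • v := by
            rw [hxe, ← Int.cast_smul_eq_zsmul ℝ]
            push_cast
            module
          obtain ⟨k, hk⟩ := hfix _ (Λ.sub_mem hx (Λ.zsmul_mem hv' b')) (by
            rw [hy, map_smul, hRv])
          rw [hy, ← Int.cast_smul_eq_zsmul ℝ] at hk
          have hk' := smul_left_injective ℝ hv0 hk
          have h1 : ((2 * a' + 1 : ℤ) : ℝ) = ((2 * k : ℤ) : ℝ) := by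
            push_cast at hk' ⊢
            linarith
          have h2 : 2 * a' + 1 = 2 * k := by exact_mod_cast h1
          omega
        · apply hw
          have hy : (1 / 2 : ℝ) • (v + v') = x - a' • v - b' • v' := by
            rw [hxe, ← Int.cast_smul_eq_zsmul ℝ, ← Int.cast_smul_eq_zsmul ℝ]
            push_cast
            module
          rw [hy]
          exact Λ.sub_mem (Λ.sub_mem hx (Λ.zsmul_mem hv _)) (Λ.zsmul_mem hv' _)
      obtain ⟨a', rfl⟩ := haeven
      have hy : x - a' • v = ((b : ℝ) / 2) • v' := by
        rw [hxe, ← Int.cast_smul_eq_zsmul ℝ]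
        push_cast
        module
      obtain ⟨k, hk⟩ := hanti _ (Λ.sub_mem hx (Λ.zsmul_mem hv a')) (by
        rw [hy, map_smul, hRv', smul_neg])
      rw [AddSubgroup.mem_closure_pair]
      exact ⟨a', k, by rw [← hk]; abel⟩
    · rw [AddSubgroup.closure_le]
      rintro x (rfl | rfl)
      exacts [hv, hv']

end Dichotomy

section NumberField

variable {L : Type*} [Field L] [NumberField L]

theorem logEmb_apply (u : (𝓞 L)ˣ) (w : InfinitePlace L) :
    logEmb L (Additive.ofMul u) w = w.mult * Real.log (w ((u : 𝓞 L) : L)) := rfl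

theorem logEmb_mem (u : (𝓞 L)ˣ) : logEmb L (Additive.ofMul u) ∈ unitLattice L := ⟨_, rfl⟩

theorem exists_logEmb_eq {x : EuclideanSpace ℝ (InfinitePlace L)} (hx : x ∈ unitLattice L) :
    ∃ u : (𝓞 L)ˣ, logEmb L (Additive.ofMul u) = x := by
  obtain ⟨u, rfl⟩ := hx
  exact ⟨u.toMul, rfl⟩

theorem sum_eq_zero_of_mem_unitLattice {x : EuclideanSpace ℝ (InfinitePlace L)}
    (hx : x ∈ unitLattice L) : ∑ w, x w = 0 := by
  obtain ⟨u, rfl⟩ := exists_logEmb_eq hx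
  exact NumberField.Units.sum_mult_mul_log u

open Units.dirichletUnitTheorem in
/-- Mathlib's logarithmic space omits the distinguished place `w₀`; on the unit lattice nothing is
lost by this. -/
theorem eq_of_forall_ne_w₀ {x y : EuclideanSpace ℝ (InfinitePlace L)} (hx : x ∈ unitLattice L)
    (hy : y ∈ unitLattice L) (h : ∀ w : InfinitePlace L, w ≠ w₀ → x w = y w) : x = y := by
  classical
  have hx' := sum_eq_zero_of_mem_unitLattice hx
  have hy' := sum_eq_zero_of_mem_unitLattice hy
  rw [← Finset.add_sum_erase _ _ (Finset.mem_univ w₀)] at hx' hy'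
  rw [Finset.sum_congr rfl fun w hw => h w (Finset.ne_of_mem_erase hw)] at hx'
  ext w
  by_cases hw : w = w₀
  · rw [hw]
    linarith
  · exact h w hw

open Units.dirichletUnitTheorem in
theorem finite_unitLattice_inter_closedBall (r : ℝ) :
    {x : EuclideanSpace ℝ (InfinitePlace L) | x ∈ unitLattice L ∧ ‖x‖ ≤ r}.Finite := by
  classical
  let ρ : EuclideanSpace ℝ (InfinitePlace L) → logSpace L := fun x w => x w.1
  refine Set.Finite.of_finite_image (f := ρ)
    ((unitLattice_inter_ball_finite L r).subset ?_) ?_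
  · rintro _ ⟨x, ⟨hx, hxr⟩, rfl⟩
    refine ⟨?_, ?_⟩
    · obtain ⟨u, rfl⟩ := exists_logEmb_eq hx
      exact ⟨Additive.ofMul u, trivial, rfl⟩
    · refine mem_closedBall_zero_iff.2 ?_
      refine (pi_norm_le_iff_of_nonneg ((norm_nonneg _).trans hxr)).2 fun w => ?_
      exact (PiLp.norm_apply_le x w.1).trans hxr
  · intro x hx y hy hxy
    exact eq_of_forall_ne_w₀ hx.1 hy.1 fun w hw => congrFun hxy ⟨w, hw⟩

open Units.dirichletUnitTheorem in
/-- By Dirichlet's unit theorem the only linear relation between the coordinates of the unit lattice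
is that their sum vanishes. -/
theorem eq_of_forall_sum_mul_logEmb_eq_zero {c : InfinitePlace L → ℝ}
    (h : ∀ x ∈ unitLattice L, ∑ w, c w * x w = 0) (w w' : InfinitePlace L) : c w = c w' := by
  classical
  suffices H : ∀ w, w ≠ w₀ → c w = c w₀ by
    by_cases hw : w = w₀ <;> by_cases hw' : w' = w₀
    · rw [hw, hw']
    · rw [hw, H w' hw']
    · rw [hw', H w hw]
    · rw [H w hw, H w' hw']
  let ℓ : logSpace L →ₗ[ℝ] ℝ :=
    ∑ w : {w : InfinitePlace L // w ≠ w₀}, (c w.1 - c w₀) • LinearMap.proj w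
  have hℓ : ℓ = 0 := by
    refine LinearMap.ext_on (unitLattice_span_eq_top L) ?_
    rintro _ ⟨u, -, rfl⟩
    have h1 := h (logEmb L u) ⟨u, rfl⟩
    have h2 := sum_eq_zero_of_mem_unitLattice (L := L) (x := logEmb L u) ⟨u, rfl⟩
    rw [Fintype.sum_eq_add_sum_subtype_ne _ w₀] at h1 h2
    have h3 : ℓ (Units.logEmbedding L u) =
        ∑ w : {w : InfinitePlace L // w ≠ w₀}, (c w.1 - c w₀) * logEmb L u w.1 := by
      simp only [ℓ, LinearMap.sum_apply, LinearMap.smul_apply, LinearMap.proj_apply, smul_eq_mul]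
      rfl
    change ℓ (Units.logEmbedding L u) = 0
    rw [h3]
    simp only [sub_mul, Finset.sum_sub_distrib, ← Finset.mul_sum]
    linear_combination h1 - c w₀ * h2
  intro w hw
  have h4 := LinearMap.congr_fun hℓ (Pi.single ⟨w, hw⟩ 1)
  simp only [ℓ, LinearMap.sum_apply, LinearMap.smul_apply, LinearMap.proj_apply, smul_eq_mul,
    LinearMap.zero_apply] at h4
  rw [Finset.sum_eq_single ⟨w, hw⟩] at h4
  · simp only [Pi.single_eq_same, mul_one] at h4
    linarith
  · intro w' _ hne
    rw [Pi.single_eq_of_ne hne, mul_zero]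
  · simp

/-- The real multiples of a vector which lie in the unit lattice form a cyclic group. -/
theorem exists_generator_smul_mem_unitLattice {e : EuclideanSpace ℝ (InfinitePlace L)}
    (he : e ≠ 0) :
    ∃ t₀ : ℝ, t₀ • e ∈ unitLattice L ∧
      ∀ t : ℝ, t • e ∈ unitLattice L → ∃ a : ℤ, t • e = a • (t₀ • e) := by
  let G : AddSubgroup ℝ :=
    (unitLattice L).comap (LinearMap.toSpanSingleton ℝ _ e).toAddMonoidHom
  have hG : ∀ t, t ∈ G ↔ t • e ∈ unitLattice L := fun t => Iff.rfl
  have hfin : {t : ℝ | t ∈ G ∧ 0 < t ∧ t ≤ 1}.Finite := by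
    refine Set.Finite.of_finite_image (f := fun t : ℝ => t • e)
      ((finite_unitLattice_inter_closedBall (L := L) ‖e‖).subset ?_)
      (smul_left_injective ℝ he).injOn
    rintro _ ⟨t, ⟨ht, h0, h1⟩, rfl⟩
    refine ⟨ht, ?_⟩
    rw [norm_smul, Real.norm_eq_abs, abs_of_pos h0]
    exact mul_le_of_le_one_left (norm_nonneg _) h1
  obtain ⟨m, hm0, hm⟩ : ∃ m : ℝ, 0 < m ∧ Disjoint (G : Set ℝ) (Set.Ioo 0 m) := by
    have hev : ∀ᶠ y in nhds (0 : ℝ), y ∉ {t : ℝ | t ∈ G ∧ 0 < t ∧ t ≤ 1} :=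
      hfin.isClosed.isOpen_compl.mem_nhds (by simp)
    obtain ⟨ε, hε, hball⟩ := Metric.eventually_nhds_iff.1 hev
    refine ⟨min ε 1, lt_min hε one_pos, Set.disjoint_left.2 fun t ht htI => ?_⟩
    have h1 : t < ε := htI.2.trans_le (min_le_left _ _)
    have h2 : t < 1 := htI.2.trans_le (min_le_right _ _)
    refine hball (y := t) ?_ ⟨ht, htI.1, h2.le⟩
    rw [Real.dist_0_eq_abs, abs_of_pos htI.1]
    exact h1
  obtain ⟨t₀, ht₀⟩ := AddSubgroup.cyclic_of_isolated_zero hm0 hm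
  refine ⟨t₀, ?_, fun t ht => ?_⟩
  · rw [← hG, ht₀]
    exact AddSubgroup.subset_closure rfl
  · rw [← hG, ht₀, AddSubgroup.mem_closure_singleton] at ht
    obtain ⟨a, rfl⟩ := ht
    exact ⟨a, by rw [smul_assoc]⟩

/-- The permutation `w ↦ w ∘ σ` of the infinite places. -/
def placePerm (σ : L ≃+* L) : Equiv.Perm (InfinitePlace L) where
  toFun w := w.comap (σ : L →+* L)
  invFun w := w.comap (σ.symm : L →+* L)
  left_inv w := by
    apply DFunLike.ext
    intro x
    simp [InfinitePlace.comap_apply]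
  right_inv w := by
    apply DFunLike.ext
    intro x
    simp [InfinitePlace.comap_apply]

/-- The isometry of logarithmic space induced by an automorphism of the field. -/
noncomputable def placeIsometry (σ : L ≃+* L) :
    EuclideanSpace ℝ (InfinitePlace L) ≃ₗᵢ[ℝ] EuclideanSpace ℝ (InfinitePlace L) :=
  LinearIsometryEquiv.piLpCongrLeft 2 ℝ ℝ (placePerm σ).symm

theorem placeIsometry_apply (σ : L ≃+* L) (x : EuclideanSpace ℝ (InfinitePlace L))
    (w : InfinitePlace L) : placeIsometry σ x w = x (w.comap (σ : L →+* L)) := rfl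

theorem mult_comap {F : Type*} [Field F] (σ : F ≃+* F) (w : InfinitePlace F) :
    (w.comap (σ : F →+* F)).mult = w.mult := by
  classical
  have h : (w.comap (σ : F →+* F)).IsReal ↔ w.IsReal := InfinitePlace.isReal_comap_iff σ
  rw [InfinitePlace.mult, InfinitePlace.mult]
  exact if_congr h rfl rfl

theorem placeIsometry_logEmb (σ : L ≃+* L) (u : (𝓞 L)ˣ) :
    placeIsometry σ (logEmb L (Additive.ofMul u)) = logEmb L (Additive.ofMul
      (Units.map (RingOfIntegers.mapRingEquiv σ : 𝓞 L →* 𝓞 L) u)) := by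
  ext w
  rw [placeIsometry_apply, logEmb_apply, logEmb_apply, mult_comap]
  rfl

theorem placeIsometry_mem (σ : L ≃+* L) {x : EuclideanSpace ℝ (InfinitePlace L)}
    (hx : x ∈ unitLattice L) : placeIsometry σ x ∈ unitLattice L := by
  obtain ⟨u, rfl⟩ := exists_logEmb_eq hx
  rw [placeIsometry_logEmb]
  exact logEmb_mem _

theorem placeIsometry_symm_apply (σ : L ≃+* L) (x : EuclideanSpace ℝ (InfinitePlace L)) :
    placeIsometry σ.symm (placeIsometry σ x) = x := by
  ext w
  exact congrArg x ((placePerm σ).right_inv w)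

/-- The action of a field automorphism on the unit lattice. -/
noncomputable def unitLatticeAut (σ : L ≃+* L) : unitLattice L ≃+ unitLattice L where
  toFun x := ⟨placeIsometry σ x, placeIsometry_mem σ x.2⟩
  invFun x := ⟨placeIsometry σ.symm x, placeIsometry_mem σ.symm x.2⟩
  left_inv _ := Subtype.ext (placeIsometry_symm_apply σ _)
  right_inv _ := Subtype.ext (placeIsometry_symm_apply σ.symm _)
  map_add' _ _ := Subtype.ext (map_add (placeIsometry σ) _ _)

/-- A nontrivial automorphism moves every real place. -/
theorem comap_ne_of_isReal {F : Type*} [Field F] {σ : F ≃+* F} (hσ : σ ≠ RingEquiv.refl F)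
    {w : InfinitePlace F} (hw : w.IsReal) : w.comap (σ : F →+* F) ≠ w := by
  intro h
  apply hσ
  have hφ : ComplexEmbedding.IsReal w.embedding := InfinitePlace.isReal_iff.1 hw
  rw [← InfinitePlace.mk_embedding w, InfinitePlace.comap_mk, eq_comm,
    InfinitePlace.mk_eq_iff] at h
  have h' : w.embedding = w.embedding.comp (σ : F →+* F) := by
    rcases h with h | h
    · exact h
    · rwa [ComplexEmbedding.isReal_iff.1 hφ] at h
  ext x
  exact (w.embedding.injective (RingHom.congr_fun h' x)).symm

theorem exists_places_of_hasSignature (hsig : HasSignature L 2 1) :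
    ∃ w₁ w₂ w₃ : InfinitePlace L, w₁.IsReal ∧ w₂.IsReal ∧ w₃.IsComplex ∧ w₁ ≠ w₂ ∧
      ∀ w, w = w₁ ∨ w = w₂ ∨ w = w₃ := by
  classical
  obtain ⟨h1, h2⟩ := hsig
  rw [InfinitePlace.nrRealPlaces, ← Nat.card_eq_fintype_card, Nat.card_eq_two_iff] at h1
  rw [InfinitePlace.nrComplexPlaces, ← Nat.card_eq_fintype_card, Nat.card_eq_one_iff_exists] at h2
  obtain ⟨w₁, w₂, hne, huniv⟩ := h1
  obtain ⟨w₃, hw₃⟩ := h2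
  refine ⟨w₁, w₂, w₃, w₁.2, w₂.2, w₃.2, fun h => hne (Subtype.ext h), fun w => ?_⟩
  by_cases hw : w.IsReal
  · have : (⟨w, hw⟩ : {w : InfinitePlace L // w.IsReal}) ∈ ({w₁, w₂} : Set _) := by
      rw [huniv]; trivial
    rcases this with h | h
    · exact Or.inl (congrArg Subtype.val h)
    · exact Or.inr (Or.inl (congrArg Subtype.val h))
  · exact Or.inr (Or.inr (congrArg Subtype.val
      (hw₃ ⟨w, InfinitePlace.not_isReal_iff_isComplex.1 hw⟩)))

/-- A unit with absolute value `1` at a real place is `1` or `-1`. -/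
theorem logEmb_eq_zero_of_apply_isReal {x : EuclideanSpace ℝ (InfinitePlace L)}
    (hx : x ∈ unitLattice L) {w : InfinitePlace L} (hw : w.IsReal) (h : x w = 0) : x = 0 := by
  obtain ⟨u, rfl⟩ := exists_logEmb_eq hx
  rw [logEmb_apply, Units.dirichletUnitTheorem.mult_log_place_eq_zero,
    ← InfinitePlace.norm_embedding_of_isReal hw] at h
  set φ := InfinitePlace.embedding_of_isReal hw
  have hu : ((u : 𝓞 L) : L) = 1 ∨ ((u : 𝓞 L) : L) = -1 := by
    rcases (abs_eq zero_le_one).1 h with h | h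
    · exact Or.inl (φ.injective (by rw [h, map_one]))
    · exact Or.inr (φ.injective (by rw [h, map_neg, map_one]))
  ext w'
  rw [logEmb_apply, ← InfinitePlace.norm_embedding_eq]
  rcases hu with h | h <;> simp [h]

theorem isAlgebraic_apply_isReal {w : InfinitePlace L} (hw : w.IsReal) (x : L) :
    IsAlgebraic ℚ (w x) := by
  rw [← InfinitePlace.norm_embedding_of_isReal hw, Real.norm_eq_abs]
  have h : IsAlgebraic ℚ (InfinitePlace.embedding_of_isReal hw x) :=
    (Algebra.IsAlgebraic.isAlgebraic (R := ℚ) x).algHom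
      (InfinitePlace.embedding_of_isReal hw).toRatAlgHom
  rcases abs_choice (InfinitePlace.embedding_of_isReal hw x) with h' | h' <;> rw [h']
  exacts [h, h.neg]

/-- Gelfond–Schneider for the unit lattice: at a real place, the ratio of the coordinates of two
elements which satisfy no integral relation is transcendental. -/
theorem transcendental_div_apply_isReal {x y : EuclideanSpace ℝ (InfinitePlace L)}
    (hx : x ∈ unitLattice L) (hy : y ∈ unitLattice L) (hx0 : x ≠ 0) {w : InfinitePlace L}
    (hw : w.IsReal) (hindep : ∀ m n : ℤ, n ≠ 0 → n • y ≠ m • x) :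
    Transcendental ℚ (y w / x w) := by
  intro halg
  have hxw : x w ≠ 0 := fun h => hx0 (logEmb_eq_zero_of_apply_isReal hx hw h)
  have hrat : ¬ Irrational (y w / x w) := by
    obtain ⟨u, rfl⟩ := exists_logEmb_eq hx
    obtain ⟨v, rfl⟩ := exists_logEmb_eq hy
    have hm : w.mult = 1 := by rw [InfinitePlace.mult, if_pos hw]
    simp only [logEmb_apply, hm, Nat.cast_one, one_mul] at halg ⊢
    exact not_irrational_log_div_log (Units.pos_at_place u w) (Units.pos_at_place v w)
      (isAlgebraic_apply_isReal hw _) (isAlgebraic_apply_isReal hw _) halg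
  obtain ⟨q, hq⟩ : ∃ q : ℚ, (q : ℝ) = y w / x w := by simpa [Irrational] using hrat
  refine hindep q.num q.den (by exact_mod_cast q.den_ne_zero) (sub_eq_zero.1 ?_)
  refine logEmb_eq_zero_of_apply_isReal ((unitLattice L).sub_mem
    ((unitLattice L).zsmul_mem hy _) ((unitLattice L).zsmul_mem hx _)) hw ?_
  have hq' : (q.num : ℝ) / q.den = y w / x w := by
    rw [← hq]
    exact_mod_cast (Rat.num_div_den q)
  have hden : (q.den : ℝ) ≠ 0 := by exact_mod_cast q.den_ne_zero
  rw [div_eq_div_iff hden hxw] at hq'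
  rw [PiLp.sub_apply, ← Int.cast_smul_eq_zsmul ℝ, ← Int.cast_smul_eq_zsmul ℝ, PiLp.smul_apply,
    PiLp.smul_apply, smul_eq_mul, smul_eq_mul, Int.cast_natCast]
  linarith

end NumberField

/-! ### Signature (2, 1) and quadratic subfields -/

section Signature

variable {L : Type*} [Field L] [NumberField L] {w₁ w₂ w₃ : InfinitePlace L}

theorem sum_places (h₁ : w₁.IsReal) (h₂ : w₂.IsReal) (h₃ : w₃.IsComplex) (hne : w₁ ≠ w₂)
    (hall : ∀ w, w = w₁ ∨ w = w₂ ∨ w = w₃) (g : InfinitePlace L → ℝ) :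
    ∑ w, g w = g w₁ + g w₂ + g w₃ := by
  classical
  have h13 : w₁ ≠ w₃ := fun h => InfinitePlace.not_isReal_iff_isComplex.2 h₃ (h ▸ h₁)
  have h23 : w₂ ≠ w₃ := fun h => InfinitePlace.not_isReal_iff_isComplex.2 h₃ (h ▸ h₂)
  have huniv : (Finset.univ : Finset (InfinitePlace L)) = {w₁, w₂, w₃} := by
    ext w
    simpa using hall w
  rw [huniv, Finset.sum_insert (by simp [hne, h13]), Finset.sum_pair h23, add_assoc]

/-- In signature `(2, 1)` a nontrivial automorphism exchanges the two real places and fixes the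
complex one. -/
theorem comap_places {L : Type*} [Field L] {w₁ w₂ w₃ : InfinitePlace L} (h₁ : w₁.IsReal) (h₂ : w₂.IsReal) (h₃ : w₃.IsComplex)
    (hall : ∀ w, w = w₁ ∨ w = w₂ ∨ w = w₃) {σ : L ≃+* L} (hσ : σ ≠ RingEquiv.refl L) :
    w₁.comap (σ : L →+* L) = w₂ ∧ w₂.comap (σ : L →+* L) = w₁ ∧ w₃.comap (σ : L →+* L) = w₃ := by
  have hn₃ : ¬ w₃.IsReal := InfinitePlace.not_isReal_iff_isComplex.2 h₃
  have hreal : ∀ w : InfinitePlace L, (w.comap (σ : L →+* L)).IsReal ↔ w.IsReal := fun w =>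
    InfinitePlace.isReal_comap_iff σ
  refine ⟨?_, ?_, ?_⟩
  · rcases hall (w₁.comap (σ : L →+* L)) with h | h | h
    · exact absurd h (comap_ne_of_isReal hσ h₁)
    · exact h
    · exact absurd ((hreal w₁).2 h₁) (h ▸ hn₃)
  · rcases hall (w₂.comap (σ : L →+* L)) with h | h | h
    · exact h
    · exact absurd h (comap_ne_of_isReal hσ h₂)
    · exact absurd ((hreal w₂).2 h₂) (h ▸ hn₃)
  · rcases hall (w₃.comap (σ : L →+* L)) with h | h | h
    · exact absurd ((hreal w₃).1 (h ▸ h₁)) hn₃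
    · exact absurd ((hreal w₃).1 (h ▸ h₂)) hn₃
    · exact h

/-- Otherwise the first two coordinates of all units would agree, a relation which Dirichlet's
theorem excludes. -/
theorem exists_placeIsometry_ne_self (h₁ : w₁.IsReal) (h₂ : w₂.IsReal) (h₃ : w₃.IsComplex)
    (hne : w₁ ≠ w₂) (hall : ∀ w, w = w₁ ∨ w = w₂ ∨ w = w₃) {σ : L ≃+* L}
    (hσ : σ ≠ RingEquiv.refl L) : ∃ x ∈ unitLattice L, placeIsometry σ x ≠ x := by
  classical
  by_contra! hfix
  have h21 : w₂ ≠ w₁ := hne.symm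
  have h31 : w₃ ≠ w₁ := fun h => InfinitePlace.not_isReal_iff_isComplex.2 h₃ (h ▸ h₁)
  have h32 : w₃ ≠ w₂ := fun h => InfinitePlace.not_isReal_iff_isComplex.2 h₃ (h ▸ h₂)
  have h := eq_of_forall_sum_mul_logEmb_eq_zero (L := L)
    (c := fun w => if w = w₁ then 1 else if w = w₂ then -1 else 0) (fun x hx => by
      rw [sum_places h₁ h₂ h₃ hne hall]
      have h := congrArg (fun y : EuclideanSpace ℝ (InfinitePlace L) => y w₁) (hfix x hx)
      simp only [placeIsometry_apply, (comap_places h₁ h₂ h₃ hall hσ).1] at h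
      simp [h21, h31, h32, h]) w₁ w₂
  norm_num [h21] at h

/-- Otherwise the coordinate of all units at the complex place would vanish. -/
theorem exists_placeIsometry_ne_neg (h₁ : w₁.IsReal) (h₂ : w₂.IsReal) (h₃ : w₃.IsComplex)
    (hne : w₁ ≠ w₂) (hall : ∀ w, w = w₁ ∨ w = w₂ ∨ w = w₃) {σ : L ≃+* L}
    (hσ : σ ≠ RingEquiv.refl L) : ∃ x ∈ unitLattice L, placeIsometry σ x ≠ -x := by
  classical
  by_contra! hanti
  have h13 : w₁ ≠ w₃ := fun h => InfinitePlace.not_isReal_iff_isComplex.2 h₃ (h ▸ h₁)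
  have h23 : w₂ ≠ w₃ := fun h => InfinitePlace.not_isReal_iff_isComplex.2 h₃ (h ▸ h₂)
  have h := eq_of_forall_sum_mul_logEmb_eq_zero (L := L)
    (c := fun w => if w = w₃ then 1 else 0) (fun x hx => by
      rw [sum_places h₁ h₂ h₃ hne hall]
      have h := congrArg (fun y : EuclideanSpace ℝ (InfinitePlace L) => y w₃) (hanti x hx)
      simp only [placeIsometry_apply, (comap_places h₁ h₂ h₃ hall hσ).2.2, PiLp.neg_apply] at h
      have h0 : x w₃ = 0 := by linarith
      simp [h13, h23, h0]) w₁ w₃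
  norm_num [h13] at h

/-- The unit lattice has a reflection, and the ratio of the lengths of the generators of its
eigenlattices is, up to `√3`, a transcendental quotient of logarithms. -/
theorem exists_unitShape_on_boundary (hsig : HasSignature L 2 1) {σ : L ≃+* L}
    (hσ : σ ≠ RingEquiv.refl L) :
    ∃ p : ℍ, p ∈ stdDomain ∧ OnBoundary p ∧ Transcendental ℚ (p : ℂ) ∧ HasUnitShape L p := by
  classical
  obtain ⟨w₁, w₂, w₃, h₁, h₂, h₃, hne, hall⟩ := exists_places_of_hasSignature hsig
  have h21 : w₂ ≠ w₁ := hne.symm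
  have h31 : w₃ ≠ w₁ := fun h => InfinitePlace.not_isReal_iff_isComplex.2 h₃ (h ▸ h₁)
  have h32 : w₃ ≠ w₂ := fun h => InfinitePlace.not_isReal_iff_isComplex.2 h₃ (h ▸ h₂)
  obtain ⟨hσ₁, hσ₂, hσ₃⟩ := comap_places h₁ h₂ h₃ hall hσ
  have hext : ∀ x y : EuclideanSpace ℝ (InfinitePlace L), x w₁ = y w₁ → x w₂ = y w₂ →
      x w₃ = y w₃ → x = y := by
    intro x y e₁ e₂ e₃
    ext w
    rcases hall w with rfl | rfl | rfl
    exacts [e₁, e₂, e₃]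
  let R : EuclideanSpace ℝ (InfinitePlace L) →ₗ[ℝ] EuclideanSpace ℝ (InfinitePlace L) :=
    (placeIsometry σ).toLinearEquiv.toLinearMap
  have hR₁ : ∀ x, R x w₁ = x w₂ := fun x => congrArg x hσ₁
  have hR₂ : ∀ x, R x w₂ = x w₁ := fun x => congrArg x hσ₂
  have hR₃ : ∀ x, R x w₃ = x w₃ := fun x => congrArg x hσ₃
  have hRR : ∀ x, R (R x) = x := fun x =>
    hext _ _ (by rw [hR₁, hR₂]) (by rw [hR₂, hR₁]) (by rw [hR₃, hR₃])
  have hRmem : ∀ x ∈ unitLattice L, R x ∈ unitLattice L := fun x hx => placeIsometry_mem σ hx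
  have hsum : ∀ x ∈ unitLattice L, x w₁ + x w₂ + x w₃ = 0 := fun x hx => by
    rw [← sum_places h₁ h₂ h₃ hne hall]
    exact sum_eq_zero_of_mem_unitLattice hx
  -- the two eigenvectors of the reflection in the plane of vectors with coordinate sum zero
  let e : EuclideanSpace ℝ (InfinitePlace L) := WithLp.toLp 2 fun w => if w = w₃ then -2 else 1
  let e' : EuclideanSpace ℝ (InfinitePlace L) :=
    WithLp.toLp 2 fun w => if w = w₁ then 1 else if w = w₂ then -1 else 0
  have he₁ : e w₁ = 1 := if_neg h31.symm
  have he₂ : e w₂ = 1 := if_neg h32.symm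
  have he₃ : e w₃ = -2 := if_pos rfl
  have he'₁ : e' w₁ = 1 := if_pos rfl
  have he'₂ : e' w₂ = -1 := by simp [e', h21]
  have he'₃ : e' w₃ = 0 := by simp [e', h31, h32]
  have he0 : e ≠ 0 := fun h => by simp [h] at he₁
  have he'0 : e' ≠ 0 := fun h => by simp [h] at he'₁
  have hRe : R e = e := hext _ _ (by rw [hR₁, he₁, he₂]) (by rw [hR₂, he₁, he₂]) (hR₃ e)
  have hRe' : R e' = -e' := hext _ _ (by rw [hR₁, PiLp.neg_apply, he'₁, he'₂])
    (by rw [hR₂, PiLp.neg_apply, he'₁, he'₂, neg_neg]) (by rw [hR₃, PiLp.neg_apply, he'₃, neg_zero])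
  have hfixe : ∀ x ∈ unitLattice L, R x = x → x = x w₁ • e := by
    intro x hx hRx
    have h12 : x w₂ = x w₁ := by rw [← hR₁, hRx]
    have hs := hsum x hx
    refine hext _ _ ?_ ?_ ?_ <;> simp only [PiLp.smul_apply, smul_eq_mul, he₁, he₂, he₃] <;>
      linarith
  have hantie : ∀ x ∈ unitLattice L, R x = -x → x = x w₁ • e' := by
    intro x hx hRx
    have h12 : x w₂ = -x w₁ := by rw [← hR₁, hRx, PiLp.neg_apply]
    have h3 : x w₃ = -x w₃ := by
      conv_lhs => rw [← hR₃, hRx, PiLp.neg_apply]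
    refine hext _ _ ?_ ?_ ?_ <;> simp only [PiLp.smul_apply, smul_eq_mul, he'₁, he'₂, he'₃] <;>
      linarith
  obtain ⟨t, ht, htgen⟩ := exists_generator_smul_mem_unitLattice he0
  obtain ⟨s, hs, hsgen⟩ := exists_generator_smul_mem_unitLattice he'0
  -- `x + R x` is a nonzero fixed vector whenever `R x ≠ -x`
  have ht0 : t ≠ 0 := by
    rintro rfl
    obtain ⟨x, hx, hxn⟩ := exists_placeIsometry_ne_neg h₁ h₂ h₃ hne hall hσ
    have hy := (unitLattice L).add_mem hx (hRmem x hx)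
    have hfix := hfixe _ hy (by rw [map_add, hRR, add_comm])
    obtain ⟨a, ha⟩ := htgen _ (hfix ▸ hy)
    rw [← hfix, zero_smul, smul_zero] at ha
    exact hxn (eq_neg_of_add_eq_zero_right ha)
  have hs0 : s ≠ 0 := by
    rintro rfl
    obtain ⟨x, hx, hxn⟩ := exists_placeIsometry_ne_self h₁ h₂ h₃ hne hall hσ
    have hy := (unitLattice L).sub_mem hx (hRmem x hx)
    have hanti := hantie _ hy (by rw [map_sub, hRR, neg_sub])
    obtain ⟨a, ha⟩ := hsgen _ (hanti ▸ hy)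
    rw [← hanti, zero_smul, smul_zero] at ha
    exact hxn (sub_eq_zero.1 ha).symm
  have hv0 : t • e ≠ 0 := smul_ne_zero ht0 he0
  have hv'0 : s • e' ≠ 0 := smul_ne_zero hs0 he'0
  have hdich := eq_closure_or_eq_closure_half (unitLattice L) R hRmem hRR hv0 ht hs
    (by rw [map_smul, hRe]) (by rw [map_smul, hRe', smul_neg])
    (fun x hx hRx => by
      have h := hfixe x hx hRx
      obtain ⟨a, ha⟩ := htgen _ (h ▸ hx)
      exact ⟨a, h.trans ha⟩)
    (fun x hx hRx => by
      have h := hantie x hx hRx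
      obtain ⟨a, ha⟩ := hsgen _ (h ▸ hx)
      exact ⟨a, h.trans ha⟩)
  have horth : inner ℝ (t • e) (s • e') = 0 := by
    rw [real_inner_smul_left, real_inner_smul_right, PiLp.inner_apply,
      sum_places h₁ h₂ h₃ hne hall, he₁, he₂, he₃, he'₁, he'₂, he'₃]
    simp
  have htrans : Transcendental ℚ ((s • e') w₁ / (t • e) w₁) := by
    refine transcendental_div_apply_isReal ht hs hv0 h₁ fun m n hn h => hn ?_
    have c₁ := congrArg (fun y : EuclideanSpace ℝ (InfinitePlace L) => y w₁) h
    have c₂ := congrArg (fun y : EuclideanSpace ℝ (InfinitePlace L) => y w₂) h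
    simp only [← Int.cast_smul_eq_zsmul ℝ, PiLp.smul_apply, smul_eq_mul, he₁, he₂, he'₁,
      he'₂] at c₁ c₂
    have h0 : (n : ℝ) * s = 0 := by linarith
    exact_mod_cast (mul_eq_zero.1 h0).resolve_right hs0
  have htr : Transcendental ℚ (‖s • e'‖ / ‖t • e‖) := by
    intro halg
    have hnorm : ‖e‖ = Real.sqrt 6 := by
      rw [EuclideanSpace.norm_eq, sum_places h₁ h₂ h₃ hne hall, he₁, he₂, he₃]
      norm_num
    have hnorm' : ‖e'‖ = Real.sqrt 2 := by
      rw [EuclideanSpace.norm_eq, sum_places h₁ h₂ h₃ hne hall, he'₁, he'₂, he'₃]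
      norm_num
    have hsqrt : ∀ n : ℕ, IsAlgebraic ℚ (Real.sqrt n) := fun n => by
      refine IsAlgebraic.of_pow (n := 2) two_pos ?_
      rw [Real.sq_sqrt (Nat.cast_nonneg n)]
      exact isAlgebraic_natCast n
    have h6 : IsAlgebraic ℚ (Real.sqrt 6) := by exact_mod_cast hsqrt 6
    have h2 : IsAlgebraic ℚ (Real.sqrt 2) := by exact_mod_cast hsqrt 2
    have habs : |(s • e') w₁ / (t • e) w₁| = ‖s • e'‖ / ‖t • e‖ * Real.sqrt 6 * (Real.sqrt 2)⁻¹ := by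
      rw [norm_smul, norm_smul, hnorm, hnorm', PiLp.smul_apply, PiLp.smul_apply, he₁, he'₁, abs_div,
        Real.norm_eq_abs, Real.norm_eq_abs, smul_eq_mul, smul_eq_mul, mul_one, mul_one]
      have : |t| ≠ 0 := abs_ne_zero.2 ht0
      field_simp
    have halg' : IsAlgebraic ℚ |(s • e') w₁ / (t • e) w₁| := by
      rw [habs]
      exact (halg.mul h6).mul h2.inv
    apply htrans
    rcases abs_choice ((s • e') w₁ / (t • e) w₁) with h | h <;> rw [h] at halg'
    · exact halg'
    · simpa using halg'.neg
  obtain ⟨p, hp, hpb, hpt, hg⟩ := exists_boundary_point_of_orthogonal hv0 hv'0 horth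
    (unitLattice L) hdich htr
  exact ⟨p, hp, hpb, hpt, hg⟩

end Signature

/-- Two points of the standard domain which represent the same unit shape coincide. -/
theorem eq_of_hasUnitShape {L : Type*} [Field L] [NumberField L] {p q : ℍ} (hp : p ∈ stdDomain)
    (hq : q ∈ stdDomain) (hpL : HasUnitShape L p) (hqL : HasUnitShape L q) : p = q := by
  obtain ⟨f, c, hc, hf⟩ := hpL
  obtain ⟨g, d, hd, hg⟩ := hqL
  refine eq_of_planeLattice_similar hp hq (f.trans g.symm) (div_pos hc hd) fun x => ?_
  have h := hg (g.symm (f x))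
  rw [g.apply_symm_apply, hf] at h
  rw [AddEquiv.trans_apply, div_mul_eq_mul_div, eq_div_iff hd.ne', mul_comm, ← h]

/-- A quartic field whose Galois closure has a group of order `8` contains a quadratic field: its
fixing group of order `2` lies in a subgroup of order `4`. -/
theorem exists_quadratic_subfield {L : Type*} [Field L] [NumberField L] (hL : IsD4Quartic L) :
    ∃ K : IntermediateField ℚ L, Module.finrank ℚ K = 2 := by
  obtain ⟨h4, ⟨eqv⟩⟩ := hL
  let N := IntermediateField.normalClosure ℚ L (AlgebraicClosure ℚ)
  have halg : Algebra.IsAlgebraic ℚ (AlgebraicClosure ℚ) := by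
    -- the two `ℚ`-algebra structures on the algebraic closure agree only propositionally
    convert! AlgebraicClosure.isAlgebraic ℚ
  have hΩ : IsAlgClosure ℚ (AlgebraicClosure ℚ) := ⟨inferInstance, halg⟩
  have hnormal : Normal ℚ N := normalClosure.normal ℚ L (AlgebraicClosure ℚ)
  have hfin : FiniteDimensional ℚ N :=
    normalClosure.is_finiteDimensional ℚ L (AlgebraicClosure ℚ)
  have hgal : IsGalois ℚ N := ⟨⟩
  have hN : Module.finrank ℚ N = 8 := by
    rw [← IsGalois.card_aut_eq_finrank, Nat.card_congr eqv.toEquiv, DihedralGroup.nat_card]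
  let f₀ : L →ₐ[ℚ] AlgebraicClosure ℚ := IsAlgClosed.lift
  let f : L →ₐ[ℚ] N := f₀.codRestrict N.toSubalgebra fun x =>
    f₀.fieldRange_le_normalClosure ⟨x, rfl⟩
  let A : IntermediateField ℚ N := f.fieldRange
  have hA : Module.finrank ℚ A = 4 := by
    rw [← h4]
    exact (AlgEquiv.ofInjectiveField f).toLinearEquiv.finrank_eq.symm
  have hfix : Nat.card A.fixingSubgroup = 2 ^ 1 := by
    rw [IsGalois.card_fixingSubgroup_eq_finrank]
    have := Module.finrank_mul_finrank ℚ A N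
    rw [hA, hN] at this
    omega
  have hcard : Nat.card (N ≃ₐ[ℚ] N) = 8 := by rw [IsGalois.card_aut_eq_finrank, hN]
  obtain ⟨M, hM, hle⟩ := Sylow.exists_subgroup_card_pow_prime_le (G := N ≃ₐ[ℚ] N) 2 (n := 1)
    (m := 2) (by rw [hcard]; norm_num) A.fixingSubgroup hfix (by norm_num)
  let B := IntermediateField.fixedField M
  have hB : Module.finrank ℚ B = 2 := by
    have h1 := Module.finrank_mul_finrank ℚ B N
    rw [IntermediateField.finrank_fixedField_eq_card, hM, hN] at h1
    omega
  have hBA : B ≤ A := by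
    rw [← IsGalois.fixedField_fixingSubgroup A]
    exact IntermediateField.fixedField_antitone hle
  refine ⟨B.comap f, ?_⟩
  rw [((B.comap f).equivMap f).toLinearEquiv.finrank_eq, IntermediateField.map_comap_eq_self hBA, hB]

theorem exists_ringEquiv_ne_refl {L : Type*} [Field L] [NumberField L] (hL : IsD4Quartic L) :
    ∃ σ : L ≃+* L, σ ≠ RingEquiv.refl L := by
  obtain ⟨K, hK⟩ := exists_quadratic_subfield hL
  have hKL : Module.finrank K L = 2 := by
    have := Module.finrank_mul_finrank ℚ K L
    rw [hK, hL.1] at this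
    omega
  have : Algebra.IsQuadraticExtension K L := ⟨hKL⟩
  have : IsGalois K L := inferInstance
  have hcard : Nat.card (L ≃ₐ[K] L) = 2 := by rw [IsGalois.card_aut_eq_finrank, hKL]
  have : Nontrivial (L ≃ₐ[K] L) := Finite.one_lt_card_iff_nontrivial.1 (by omega)
  obtain ⟨σ, hσ⟩ := exists_ne (AlgEquiv.refl : L ≃ₐ[K] L)
  refine ⟨σ.toRingEquiv, fun h => hσ ?_⟩
  ext x
  exact RingEquiv.congr_fun h x

end UnitShape

theorem mainTheorem1 (L : Type*) [Field L] [NumberField L]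
    (hD4 : UnitShape.IsD4Quartic L) (hsig : UnitShape.HasSignature L 2 1) :
    (∃ p : ℍ, UnitShape.IsUnitShapePoint L p ∧
      Transcendental ℚ (p : ℂ) ∧
      ((p.re = 0 ∧ 1 ≤ p.im) ∨
        (p.re ^ 2 + p.im ^ 2 = 1 ∧ 0 ≤ p.re ∧ p.re ≤ 1 / 2 ∧ 0 < p.im) ∨
        (p.re = 1 / 2 ∧ Real.sqrt 3 / 2 ≤ p.im))) ∧
    (∀ K : IntermediateField ℚ L, Module.finrank ℚ K = 2 →
      ∀ σ : L ≃ₐ[K] L, σ ≠ AlgEquiv.refl →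
        ∃ T : UnitShape.unitLattice L ≃+ UnitShape.unitLattice L,
          (∀ u : (𝓞 L)ˣ, T (UnitShape.unitClass u) =
            UnitShape.unitClass
              (Units.map (RingOfIntegers.mapRingEquiv σ.toRingEquiv : 𝓞 L →* 𝓞 L) u)) ∧
          (∀ x, ‖T x‖ = ‖x‖) ∧ (∃ x, T x ≠ x) ∧ (∃ x, T x ≠ -x)) := by
  constructor
  · obtain ⟨σ, hσ⟩ := UnitShape.exists_ringEquiv_ne_refl hD4
    obtain ⟨p, hp, hpb, hpt, hpL⟩ := UnitShape.exists_unitShape_on_boundary hsig hσ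
    exact ⟨p, ⟨⟨hp, hpL⟩, fun q hq hqL => UnitShape.eq_of_hasUnitShape hq hp hqL hpL⟩, hpt, hpb⟩
  · intro K _ σ hσ
    have hσ' : σ.toRingEquiv ≠ RingEquiv.refl L := fun h =>
      hσ (AlgEquiv.ext fun x => RingEquiv.congr_fun h x)
    obtain ⟨w₁, w₂, w₃, h₁, h₂, h₃, hne, hall⟩ := UnitShape.exists_places_of_hasSignature hsig
    refine ⟨UnitShape.unitLatticeAut σ.toRingEquiv, fun u => ?_, fun x => ?_, ?_, ?_⟩
    · exact Subtype.ext (UnitShape.placeIsometry_logEmb σ.toRingEquiv u)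
    · exact (UnitShape.placeIsometry σ.toRingEquiv).norm_map x
    · obtain ⟨x, hx, hxn⟩ := UnitShape.exists_placeIsometry_ne_self h₁ h₂ h₃ hne hall hσ'
      exact ⟨⟨x, hx⟩, fun h => hxn (congrArg Subtype.val h)⟩
    · obtain ⟨x, hx, hxn⟩ := UnitShape.exists_placeIsometry_ne_neg h₁ h₂ h₃ hne hall hσ'
      exact ⟨⟨x, hx⟩, fun h => hxn (congrArg Subtype.val h)⟩
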